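/- **Model.** A deterministic MPC algorithm runs on $M$ machines, each with a memory of $S$ words of $O(\log n)$ bits, in synchronous rounds. In a round each machine sends a (possibly different) message to each machine and then performs an arbitrary deterministic local computation on its stored and received data; no machine ever stores, sends or receives (in one round) or outputs more than $S$ words. The machines know $n$, $M$, the size $C$ of the color space and their own index. Initially the edges $\{\mathrm{Id}_u,\mathrm{Id}_v\}$ of the graph and the list entries $(\mathrm{Id}_v,c)$, $c\in L(v)$, are distributed adversarially over the machines, subject only to each machine's share fitting into its memory. The round complexity is the number of rounds until all machines have stopped; at that time the machines together output, for every node, exactly one pair $(\mathrm{Id}_v,\phi(v))$. *Linear memory* means $S=\tilde O(n)$ (with $S\ge n$) and $M=\tilde O((n+m)/S)$, where $m$ is the number of edges; $S$ and $M$, i.e. the constants and polylogarithmic factors hidden in $\tilde O$, are chosen by the designer of the algorithm such that the whole input fits on the machines. A $(\mathrm{degree}+1)$-list coloring instance consists of a simple graph $G=(V,E)$ with $n$ nodes, distinct node identifiers from $\{0,\dots,\mathrm{poly}(n)-1\}$, and lists $L(v)\subseteq\{0,\dots,C-1\}$ with $|L(v)|=\deg(v)+1$ for all $v\in V$, where $C\le\mathrm{poly}(n)$.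 It is solved by a proper coloring $\phi$ of $G$ with $\phi(v)\in L(v)$ for all $v$. Let $\Delta$ be the maximum degree of $G$; it is not known to the machines. **Theorem.** For every fixed polynomial bound on the identifiers and on $C$ (namely identifiers less than $(n+1)^\kappa$ and $C\le (n+1)^\kappa$, for a constant $\kappa$), there is a deterministic MPC algorithm with linear memory that solves every $(\mathrm{degree}+1)$-list coloring instance, under every initial distribution of the input, in $O(1+\log\Delta\cdot\log C)$ rounds (with $\log 0:=0$). In particular, on instances with $C\le(\Delta+1)^{d}$ for a constant $d$ (that is, $C=\mathrm{poly}(\Delta)$), the same algorithm takes $O(1+\log^2\Delta)$ rounds, the hidden constant depending only on $\kappa$ and $d$. -/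

import Mathlib

/-- An instance of (degree+1)-list coloring on `n` nodes with color space `{0, …, C-1}`: a graph,
distinct node identifiers, and a list of exactly `deg v + 1` colors for every node `v`. -/
structure ListColoringInstance (n C : ℕ) where
  G : SimpleGraph (Fin n)
  decAdj : DecidableRel G.Adj
  ident : Fin n ↪ ℕ
  L : Fin n → Finset ℕ
  L_subset : ∀ v, L v ⊆ Finset.range C
  card_L : ∀ v, (L v).card = G.degree v + 1

attribute [instance] ListColoringInstance.decAdj

namespace ListColoringInstance

variable {n C : ℕ}

/-- The number `m` of edges. -/
def numEdges (I : ListColoringInstance n C) : ℕ := I.G.edgeFinset.card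

/-- The maximum degree `Δ`. -/
def maxDeg (I : ListColoringInstance n C) : ℕ := I.G.maxDegree

/-- `φ` is a proper coloring in which every node has a color from its own list. -/
def IsListColoring (I : ListColoringInstance n C) (φ : Fin n → ℕ) : Prop :=
  (∀ u v, I.G.Adj u v → φ u ≠ φ v) ∧ ∀ v, φ v ∈ I.L v

end ListColoringInstance

/-- The part of the input that one machine holds at the start: edges `{Id u, Id v}` and list
entries `(Id u, c)`. -/
structure InputShare where
  edges : Finset (Sym2 ℕ)
  entries : Finset (ℕ × ℕ)

/-- The number of words of a share; an edge and a list entry take two words each. -/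
def InputShare.words (x : InputShare) : ℕ := 2 * x.edges.card + 2 * x.entries.card

/-- What the machine `i` holds when the edge `e` is placed on machine `edgeLoc e` and the list
entry of node `v` and color `c` on machine `listLoc v c`. -/
def ListColoringInstance.shareOf {n C : ℕ} (I : ListColoringInstance n C) {M : ℕ}
    (edgeLoc : Sym2 (Fin n) → Fin M) (listLoc : Fin n → ℕ → Fin M) (i : Fin M) : InputShare where
  edges := (I.G.edgeFinset.filter fun e => edgeLoc e = i).image (Sym2.map I.ident)
  entries := ((Finset.univ.sigma I.L).filter fun p => listLoc p.1 p.2 = i).image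
    fun p => (I.ident p.1, p.2)

/-- An arbitrary (adversarial) placement of all edges and list entries on `M` machines, such that
the share of each machine fits into its memory of `S` words. -/
structure InputDistribution {n C : ℕ} (I : ListColoringInstance n C) (M S : ℕ) where
  edgeLoc : Sym2 (Fin n) → Fin M
  listLoc : Fin n → ℕ → Fin M
  fits : ∀ i, (I.shareOf edgeLoc listLoc i).words ≤ S

/-- The initial share of machine `i`. -/
def InputDistribution.share {n C : ℕ} {I : ListColoringInstance n C} {M S : ℕ}
    (D : InputDistribution I M S) (i : Fin M) : InputShare :=
  I.shareOf D.edgeLoc D.listLoc i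

/-- A deterministic algorithm for `M` machines. A word is an element of `Fin W`; the memory content
of a machine and every message is a list of words. Local computation is arbitrary.
`start` encodes the input share, `send i s j` is the message from machine `i` with memory `s` to
machine `j`, `update i s r` is the new memory when `r j` was received from machine `j`, and
`output i s` is `none` as long as the machine runs, and `some o` when it has stopped with the
list `o` of pairs (identifier, color). -/
structure MPCAlgorithm (M W : ℕ) where
  start : Fin M → InputShare → List (Fin W)
  send : Fin M → List (Fin W) → Fin M → List (Fin W)
  update : Fin M → List (Fin W) → (Fin M → List (Fin W)) → List (Fin W)
  output : Fin M → List (Fin W) → Option (List (ℕ × ℕ))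

namespace MPCAlgorithm

variable {M W : ℕ}

/-- The message from machine `i` to machine `j` in the round that starts in configuration `c`.
A machine that has stopped sends nothing. -/
def message (A : MPCAlgorithm M W) (c : Fin M → List (Fin W)) (i j : Fin M) : List (Fin W) :=
  if (A.output i (c i)).isSome then [] else A.send i (c i) j

/-- One synchronous round. A machine that has stopped does not change any more. -/
def round (A : MPCAlgorithm M W) (c : Fin M → List (Fin W)) : Fin M → List (Fin W) := fun i =>
  if (A.output i (c i)).isSome then c i else A.update i (c i) fun j => A.message c j i

/-- The memory contents of all machines after `t` rounds on input `x`. -/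
def run (A : MPCAlgorithm M W) (x : Fin M → InputShare) (t : ℕ) : Fin M → List (Fin W) :=
  A.round^[t] fun i => A.start i (x i)

/-- No machine ever stores, sends (in one round), receives (in one round) or outputs more than
`S` words. -/
def RespectsMemory (A : MPCAlgorithm M W) (S : ℕ) (x : Fin M → InputShare) : Prop :=
  ∀ t i,
    (A.run x t i).length ≤ S ∧
    ∑ j, (A.message (A.run x t) i j).length ≤ S ∧
    ∑ j, (A.message (A.run x t) j i).length ≤ S ∧
    ∀ o ∈ A.output i (A.run x t i), 2 * o.length ≤ S

/-- With memory `S` per machine and input distribution `D`, all machines have stopped after `T`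
rounds, and together they output exactly one color for each node, forming a list coloring. -/
def SolvesIn (A : MPCAlgorithm M W) {n C S : ℕ} {I : ListColoringInstance n C}
    (D : InputDistribution I M S) (T : ℕ) : Prop :=
  A.RespectsMemory S D.share ∧
  ∃ out : Fin M → List (ℕ × ℕ),
    (∀ i, A.output i (A.run D.share T i) = some (out i)) ∧
    ∃ φ : Fin n → ℕ, I.IsListColoring φ ∧
      ∑ i, (out i : Multiset (ℕ × ℕ)) = Finset.univ.val.map fun v => (I.ident v, φ v)

end MPCAlgorithm

/-- The linear memory regime. On graphs with `n` nodes and `m` edges, there are `M n m` machines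
with `S n` words each, and words are elements of `Fin (W n)`:
`S = Õ(n)` (and at least `n`), words have `O(log n)` bits, `M = Õ((n + m) / S)`, and all `m` edges
and `n + 2 m` list entries have room on the machines. -/
def IsLinearMemoryRegime (S W : ℕ → ℕ) (M : ℕ → ℕ → ℕ) : Prop :=
  ∃ a b : ℕ, ∀ n : ℕ,
    n ≤ S n ∧ S n ≤ a * n * (Nat.log 2 n + 1) ^ b ∧
    W n ≤ (n + 1) ^ a ∧
    ∀ m ≤ n.choose 2,
      M n m * S n ≤ a * (n + m) * (Nat.log 2 n + 1) ^ b ∧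
      n + 3 * m ≤ M n m * (S n / 2)

/-! The coloring is built in phases by a derandomized random trial. In a phase every uncolored node
builds a candidate color bit by bit. For a prefix, the slack of a node is the number of its list
colors with that prefix minus the number of its neighbors already colored with that prefix. The next
bit is drawn with probabilities proportional to the slacks `z 0`, `z 1` of the two extensions, `s`
being their sum. The potential sums, over uncolored nodes `u`, the number of rivals (uncolored
neighbors with the same prefix) divided by the slack of `u`. If the bits of `u` and a rival `w` are
independent, the pair contributes in expectation P(w takes 0)·(z 0/s)/z 0 + P(w takes 1)·(z 1/s)/z 1
= 1/s, so the potential does not grow. Since lists have deg + 1 colors, the slack initially exceeds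
the number of rivals, and the potential is at most the number of uncolored nodes. At the end every
slack is 1, so a node has on average little more than one rival. Keeping the candidates of nodes
without a rival of smaller identifier then colors at least a quarter of the uncolored nodes.

Pairwise independence suffices, so the bits come from an affine hash of the ranks modulo a prime `q`
of order n·polylog(n). The two coefficients of the seed are fixed one after the other, each by
minimizing over `q` values a cost that is additive over the edges; one choice is thus one sum of
vectors with `q` coordinates. Integral weights and thresholds lose a factor (1 + n/q)² per bit,
which the size of `q` makes harmless. The core is `sum_conflict_weight_le`, `PrefixInvariant.step`
and `PrefixInvariant.card_uncolored_keepColors_le`.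

After O(log Δ) phases, the degrees plus one of the uncolored nodes sum to at most 2n. The rest of
the input is then made public, and a completion exists by the greedy argument
(`IsPartialColoring.exists_extension`).

The machines share a public state, which evolves by sums of vectors (two rounds) and unions of sets
(logarithmically many rounds in the number of machines). Only two unions occur, and there are at
most Δ + 1 machines (`numMachines_le`), so unions cost O(log Δ) rounds. The public state is stored
as the history of all step results, which takes n·polylog(n) words.
`BoardProtocol.exists_mpcAlgorithm` turns such a protocol into an algorithm, and
`ProtocolSetting.exists_path` runs the coloring protocol. -/

/-! ### Encoding data in machine words -/

/-- The elements of `P` can be stored in `k` words from `Fin W`. -/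
def Fits {α : Type} (W : ℕ) (P : Set α) (k : ℕ) : Prop :=
  ∃ f : α → Fin k → Fin W, Set.InjOn f P

namespace Fits

variable {α γ : Type} {W k l : ℕ} {P Q : Set α}

theorem subset (h : Fits W Q k) (hPQ : P ⊆ Q) : Fits W P k := by
  obtain ⟨f, hf⟩ := h
  exact ⟨f, hf.mono hPQ⟩

theorem singleton [NeZero W] (a : α) : Fits W {a} k :=
  ⟨fun _ _ => 0, Set.injOn_singleton _ _⟩

theorem mono [NeZero W] (h : Fits W P k) (hkl : k ≤ l) : Fits W P l := by
  obtain ⟨f, hf⟩ := h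
  refine ⟨fun x i => if hi : i.1 < k then f x ⟨i, hi⟩ else 0, ?_⟩
  intro x hx y hy hxy
  refine hf hx hy (funext fun i => ?_)
  have := congrFun hxy ⟨i, i.2.trans_le hkl⟩
  simpa using this

/-- A value is stored as the code of a chosen preimage, so `g` need not be injective. This allows a
public state to be stored as a history that leads to it. -/
theorem image [NeZero W] (h : Fits W P k) (g : α → γ) : Fits W (g '' P) k := by
  classical
  obtain ⟨f, hf⟩ := h
  rcases isEmpty_or_nonempty α with hα | hα
  · exact ⟨fun _ _ => 0, by simp [Set.eq_empty_of_isEmpty P]⟩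
  · refine ⟨fun c => f (Function.invFunOn g P c), ?_⟩
    rintro _ ⟨x, hx, rfl⟩ _ ⟨y, hy, rfl⟩ hxy
    have hx' := Function.invFunOn_mem (f := g) (s := P) ⟨x, hx, rfl⟩
    have hy' := Function.invFunOn_mem (f := g) (s := P) ⟨y, hy, rfl⟩
    have h1 := hf hx' hy' hxy
    have hx2 := Function.invFunOn_eq (f := g) (s := P) ⟨x, hx, rfl⟩
    have hy2 := Function.invFunOn_eq (f := g) (s := P) ⟨y, hy, rfl⟩
    rw [← hx2, ← hy2, h1]

theorem prod {Q : Set γ} (h : Fits W P k) (h' : Fits W Q l) : Fits W (P ×ˢ Q) (k + l) := by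
  obtain ⟨f, hf⟩ := h
  obtain ⟨g, hg⟩ := h'
  refine ⟨fun x => Fin.append (f x.1) (g x.2), ?_⟩
  rintro ⟨x, y⟩ ⟨hx, hy⟩ ⟨x', y'⟩ ⟨hx', hy'⟩ h
  have h1 : f x = f x' := funext fun i => by
    simpa using congrFun h (Fin.castAdd l i)
  have h2 : g y = g y' := funext fun i => by
    simpa using congrFun h (Fin.natAdd k i)
  rw [show x = x' from hf hx hx' h1, show y = y' from hg hy hy' h2]

/-- One extra word serves as a tag for the part that the element belongs to. -/
theorem union (hW : 2 ≤ W) (h : Fits W P k) (h' : Fits W Q k) : Fits W (P ∪ Q) (k + 1) := by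
  classical
  obtain ⟨f, hf⟩ := h
  obtain ⟨g, hg⟩ := h'
  refine ⟨fun x => if x ∈ P then Fin.cons ⟨0, by omega⟩ (f x) else Fin.cons ⟨1, by omega⟩ (g x), ?_⟩
  intro x hx y hy hxy
  by_cases hxP : x ∈ P <;> by_cases hyP : y ∈ P <;> simp only [hxP, hyP, if_true, if_false] at hxy
  · exact hf hxP hyP (Fin.cons_inj.1 hxy).2
  · simpa using (Fin.cons_inj.1 hxy).1
  · simpa using (Fin.cons_inj.1 hxy).1
  · exact hg (hx.resolve_left hxP) (hy.resolve_left hyP) (Fin.cons_inj.1 hxy).2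

theorem of_lt [NeZero W] (f : α → ℕ) (hf : Set.InjOn f P) (hlt : ∀ x ∈ P, f x < W) : Fits W P 1 := by
  refine ⟨fun x _ => Fin.ofNat W (f x), fun x hx y hy hxy => hf hx hy ?_⟩
  have := congrArg Fin.val (congrFun hxy 0)
  simpa [Nat.mod_eq_of_lt (hlt x hx), Nat.mod_eq_of_lt (hlt y hy)] using this

theorem vector [NeZero W] (R : ℕ) :
    Fits W {f : ℕ → ℕ | (∀ r < R, f r < W) ∧ ∀ r, R ≤ r → f r = 0} R := by
  refine ⟨fun f r => Fin.ofNat W (f r), fun f hf g hg hfg => funext fun r => ?_⟩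
  by_cases hr : r < R
  · have := congrArg Fin.val (congrFun hfg ⟨r, hr⟩)
    simpa [Nat.mod_eq_of_lt (hf.1 r hr), Nat.mod_eq_of_lt (hg.1 r hr)] using this
  · rw [hf.2 r (not_lt.1 hr), hg.2 r (not_lt.1 hr)]

theorem list_eq [NeZero W] (h : Fits W P k) :
    ∀ m : ℕ, Fits W {l : List α | l.length = m ∧ ∀ x ∈ l, x ∈ P} (m * k)
  | 0 => (singleton ([] : List α)).subset fun l hl => by simpa using hl.1
  | m + 1 => by
    have h1 := ((h.prod (list_eq h m)).image fun x => x.1 :: x.2).mono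
      (show k + m * k ≤ (m + 1) * k by linarith [add_one_mul m k])
    refine h1.subset fun l hl => ?_
    rcases l with _ | ⟨a, l⟩
    · simp at hl
    · exact ⟨(a, l), ⟨hl.2 a (by simp), by simpa using hl.1, fun x hx => hl.2 x (by simp [hx])⟩, rfl⟩

theorem list_le (hW : 2 ≤ W) (h : Fits W P k) (m : ℕ) :
    Fits W {l : List α | l.length ≤ m ∧ ∀ x ∈ l, x ∈ P} (m * (k + 1)) := by
  have : NeZero W := ⟨by omega⟩
  induction m with
  | zero => exact (singleton ([] : List α)).subset fun l hl => by simpa using hl.1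
  | succ m ih =>
    have h1 := (h.prod ih).image fun x => x.1 :: x.2
    have h2 := (h1.union hW (singleton ([] : List α))).mono
      (show k + m * (k + 1) + 1 ≤ (m + 1) * (k + 1) by linarith [add_one_mul m (k + 1)])
    refine h2.subset fun l hl => ?_
    rcases l with _ | ⟨a, l⟩
    · exact Or.inr rfl
    · exact Or.inl ⟨(a, l), ⟨hl.2 a (by simp), by simpa using hl.1,
        fun x hx => hl.2 x (by simp [hx])⟩, rfl⟩

/-- A nonempty set is listed and padded to length `m` by repeating one of its elements; the
additional word is the tag that separates off the empty set. -/
theorem finset (hW : 2 ≤ W) (h : Fits W P 1) (m : ℕ) :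
    Fits W {s : Finset α | (∀ x ∈ s, x ∈ P) ∧ s.card ≤ m} (m + 1) := by
  classical
  have : NeZero W := ⟨by omega⟩
  have h1 := (h.list_eq m).image List.toFinset
  rw [mul_one] at h1
  refine (h1.union hW (singleton ∅)).subset fun s hs => ?_
  rcases s.eq_empty_or_nonempty with rfl | ⟨a, ha⟩
  · exact Or.inr rfl
  · refine Or.inl ⟨s.toList ++ List.replicate (m - s.card) a, ⟨?_, ?_⟩, ?_⟩
    · have := hs.2
      simp; omega
    · intro x hx
      rcases List.mem_append.1 hx with hx | hx
      · exact hs.1 x (by simpa using hx)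
      · rw [List.eq_of_mem_replicate hx]; exact hs.1 a ha
    · ext x
      simp only [List.mem_toFinset, List.mem_append, Finset.mem_toList, List.mem_replicate]
      constructor
      · rintro (h | ⟨-, rfl⟩) <;> assumption
      · exact Or.inl

/-- Encoding into memory contents, with a decoding function. -/
theorem exists_code [Nonempty α] (h : Fits W P k) :
    ∃ (enc : α → List (Fin W)) (dec : List (Fin W) → α),
      (∀ x, (enc x).length = k) ∧ ∀ x ∈ P, dec (enc x) = x := by
  obtain ⟨f, hf⟩ := h
  refine ⟨fun x => List.ofFn (f x), Function.invFunOn (fun x => List.ofFn (f x)) P, by simp,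
    fun x hx => ?_⟩
  have hinj : Set.InjOn (fun x => List.ofFn (f x)) P := fun x hx y hy hxy =>
    hf hx hy (List.ofFn_injective hxy)
  exact hinj.leftInvOn_invFunOn hx

theorem exists_word [Nonempty α] (h : Fits W P 1) :
    ∃ (enc : α → Fin W) (dec : Fin W → α), ∀ x ∈ P, dec (enc x) = x := by
  obtain ⟨f, hf⟩ := h
  have hinj : Set.InjOn (fun x => f x 0) P := fun x hx y hy hxy =>
    hf hx hy (funext fun i => by rw [Subsingleton.elim i 0]; exact hxy)
  exact ⟨fun x => f x 0, Function.invFunOn (fun x => f x 0) P, fun x hx => hinj.leftInvOn_invFunOn hx⟩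

end Fits

/-! ### Algorithms with states of arbitrary type -/

/-- A message-passing algorithm whose machines have states in an arbitrary type. -/
structure TypedAlgorithm (M W : ℕ) (σ : Type) where
  start : Fin M → InputShare → σ
  send : Fin M → σ → Fin M → List (Fin W)
  update : Fin M → σ → (Fin M → List (Fin W)) → σ
  output : Fin M → σ → Option (List (ℕ × ℕ))

namespace TypedAlgorithm

variable {M W : ℕ} {σ : Type}

def message (A : TypedAlgorithm M W σ) (c : Fin M → σ) (i j : Fin M) : List (Fin W) :=
  if (A.output i (c i)).isSome then [] else A.send i (c i) j

def round (A : TypedAlgorithm M W σ) (c : Fin M → σ) : Fin M → σ := fun i =>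
  if (A.output i (c i)).isSome then c i else A.update i (c i) fun j => A.message c j i

def run (A : TypedAlgorithm M W σ) (x : Fin M → InputShare) (t : ℕ) : Fin M → σ :=
  A.round^[t] fun i => A.start i (x i)

/-- The algorithm whose memory contents are encodings of the states of `A`. -/
def encode (A : TypedAlgorithm M W σ) (enc : σ → List (Fin W)) (dec : List (Fin W) → σ) :
    MPCAlgorithm M W where
  start i x := enc (A.start i x)
  send i s := A.send i (dec s)
  update i s r := enc (A.update i (dec s) r)
  output i s := A.output i (dec s)

variable {A : TypedAlgorithm M W σ} {enc : σ → List (Fin W)} {dec : List (Fin W) → σ}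

theorem encode_message {c : Fin M → σ} (hc : ∀ i, dec (enc (c i)) = c i) (i j : Fin M) :
    (A.encode enc dec).message (fun i => enc (c i)) i j = A.message c i j := by
  simp [MPCAlgorithm.message, message, encode, hc]

theorem encode_round {c : Fin M → σ} (hc : ∀ i, dec (enc (c i)) = c i) :
    (A.encode enc dec).round (fun i => enc (c i)) = fun i => enc (A.round c i) := by
  funext i
  have h := fun j => encode_message (A := A) hc j i
  have h' : (A.encode enc dec).output i (enc (c i)) = A.output i (c i) := by simp [encode, hc]
  simp only [MPCAlgorithm.round, round, h, h']
  split_ifs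
  · rfl
  · simp [encode, hc]

/-- Decoding has to be correct only on reachable states, so an encoding of a small set containing
them is enough. -/
theorem encode_run {x : Fin M → InputShare} (h : ∀ t i, dec (enc (A.run x t i)) = A.run x t i)
    (t : ℕ) : (A.encode enc dec).run x t = fun i => enc (A.run x t i) := by
  induction t with
  | zero => rfl
  | succ t ih =>
    have e : A.run x (t + 1) = A.round (A.run x t) := Function.iterate_succ_apply' _ _ _
    rw [e, ← encode_round (h t), ← ih]
    exact Function.iterate_succ_apply' _ _ _

/-- If all reachable states lie in a set that fits into `S` words and the communication is bounded
by `S`, then the encoded algorithm respects the memory bound, and its outputs are those of `A`. -/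
theorem encode_solvesIn {n C S T : ℕ} {I : ListColoringInstance n C} {D : InputDistribution I M S}
    (hlen : ∀ s, (enc s).length ≤ S) (h : ∀ t i, dec (enc (A.run D.share t i)) = A.run D.share t i)
    (hsend : ∀ t i, ∑ j, (A.message (A.run D.share t) i j).length ≤ S)
    (hrecv : ∀ t i, ∑ j, (A.message (A.run D.share t) j i).length ≤ S)
    (hout : ∀ t i, ∀ o ∈ A.output i (A.run D.share t i), 2 * o.length ≤ S)
    (out : Fin M → List (ℕ × ℕ)) (φ : Fin n → ℕ)
    (hfin : ∀ i, A.output i (A.run D.share T i) = some (out i)) (hφ : I.IsListColoring φ)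
    (hsum : ∑ i, (out i : Multiset (ℕ × ℕ)) = Finset.univ.val.map fun v => (I.ident v, φ v)) :
    (A.encode enc dec).SolvesIn D T := by
  refine ⟨fun t i => ?_, out, fun i => ?_, φ, hφ, hsum⟩
  · rw [encode_run h t]
    refine ⟨hlen _, ?_, ?_, ?_⟩
    · simpa only [encode_message (h t)] using hsend t i
    · simpa only [encode_message (h t)] using hrecv t i
    · simpa [encode, h t i] using hout t i
  · rw [encode_run h T]
    simpa [encode, h T i] using hfin i

end TypedAlgorithm

/-! ### Board protocols and their simulation by message passing -/

theorem finRotate_pow_val {M : ℕ} (t : ℕ) (i : Fin M) :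
    ((finRotate M ^ t) i).val = (i.val + t) % M := by
  obtain ⟨m, rfl⟩ : ∃ m, M = m + 1 := ⟨M - 1, by have := i.2; omega⟩
  induction t with
  | zero => simp [Nat.mod_eq_of_lt i.2]
  | succ t ih =>
    rw [pow_succ', Equiv.Perm.mul_apply, finRotate_apply, Fin.val_add, ih, Fin.val_one',
      Nat.add_mod_mod, Nat.mod_add_mod, add_assoc]

theorem exists_finRotate_pow_eq {M : ℕ} (i j : Fin M) : ∃ t < M, (finRotate M ^ t) i = j := by
  have hi := i.2
  have hj := j.2
  refine ⟨(j.val + (M - i.val)) % M, Nat.mod_lt _ (by omega), Fin.ext ?_⟩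
  rw [finRotate_pow_val, Nat.add_mod_mod, show i.val + (j.val + (M - i.val)) = j.val + M by omega,
    Nat.add_mod_right, Nat.mod_eq_of_lt hj]

/-- A protocol in which all machines share a public state. In every step each machine computes,
from its input share and the public state, either a vector of numbers or a set of items; the new
public state depends on the sum of the vectors or on the union of the sets. -/
structure BoardProtocol (α β : Type) where
  init : β
  isUnion : β → Bool
  vec : β → InputShare → ℕ → ℕ
  set : β → InputShare → Finset α
  nextSum : β → (ℕ → ℕ) → β
  nextUnion : β → Finset α → β
  out : β → Option (List (ℕ × ℕ))

/-- The data that a machine holds in the middle of a step of a board protocol. -/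
inductive Work (α : Type)
  | idle
  | partialSum (v : ℕ → ℕ)
  | merge (k : ℕ) (Y : Finset α)

namespace BoardProtocol

variable {α β : Type} [DecidableEq α] {M W : ℕ}

section Public

variable (P : BoardProtocol α β) (R : ℕ)

/-- The vector of a machine, cut off after `R` coordinates. -/
def coord (b : β) (x : InputShare) (r : ℕ) : ℕ := if r < R then P.vec b x r else 0

def sumResult (x : Fin M → InputShare) (b : β) (r : ℕ) : ℕ := ∑ i, P.coord R b (x i) r

def unionResult (x : Fin M → InputShare) (b : β) : Finset α :=
  Finset.univ.biUnion fun i => P.set b (x i)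

/-- One step of the public state. -/
def next (x : Fin M → InputShare) (b : β) : β :=
  if P.isUnion b then P.nextUnion b (P.unionResult x b) else P.nextSum b (P.sumResult R x b)

/-- The public state after `k` steps. -/
def state (x : Fin M → InputShare) (k : ℕ) : β := (P.next R x)^[k] P.init

theorem state_succ (x : Fin M → InputShare) (k : ℕ) :
    P.state R x (k + 1) = P.next R x (P.state R x k) :=
  Function.iterate_succ_apply' _ _ _

/-- The number of rounds for a step: a sum takes two rounds, a union `K` rounds. -/
def cost (K : ℕ) (b : β) : ℕ := if P.isUnion b then K else 2

end Public

section Simulation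

variable (P : BoardProtocol α β) (R K : ℕ) [NeZero W] (enc : α → Fin W) (dec : Fin W → α)

/-- The number of coordinates of a sum that one machine is responsible for. -/
def chunkSize (M : ℕ) : ℕ := R / M + 1

/-- The message to machine `j` of a machine `i` that holds the set `Y` in round `k` of a union. -/
noncomputable def mergeSend (i : Fin M) (k : ℕ) (Y : Finset α) (j : Fin M) : List (Fin W) :=
  if (finRotate M ^ 2 ^ k) j = i then Y.toList.map enc else []

def afterMerge (x : InputShare) (b : β) (k : ℕ) (Y : Finset α) (r : Fin M → List (Fin W)) :
    InputShare × β × Work α :=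
  let Y' := Y ∪ Finset.univ.biUnion fun j => (r j).toFinset.image dec
  if k + 1 < K then (x, b, .merge (k + 1) Y') else (x, P.nextUnion b Y', .idle)

/-- The implementation of a board protocol. Sums are computed by distributing the coordinates over
the machines and broadcasting the results, unions by doubling along a cycle of the machines. -/
noncomputable def simulate : TypedAlgorithm M W (InputShare × β × Work α) where
  start _ x := (x, P.init, .idle)
  send i s j := match s.2.2 with
    | .idle => if P.isUnion s.2.1 then mergeSend enc i 0 (P.set s.2.1 s.1) j else
        (List.range (chunkSize R M)).map fun k =>
          Fin.ofNat W (P.coord R s.2.1 s.1 (j * chunkSize R M + k))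
    | .partialSum v => (List.range (chunkSize R M)).map fun k => Fin.ofNat W (v k)
    | .merge k Y => mergeSend enc i k Y j
  update _ s r := match s.2.2 with
    | .idle => if P.isUnion s.2.1 then P.afterMerge K dec s.1 s.2.1 0 (P.set s.2.1 s.1) r else
        (s.1, s.2.1, .partialSum fun k =>
          if k < chunkSize R M then ∑ j, ((r j).getD k 0).val else 0)
    | .partialSum _ => (s.1, P.nextSum s.2.1 fun q =>
        if h : q < R ∧ q / chunkSize R M < M then
          ((r ⟨q / chunkSize R M, h.2⟩).getD (q % chunkSize R M) 0).val else 0, .idle)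
    | .merge k Y => P.afterMerge K dec s.1 s.2.1 k Y r
  output i s := match s.2.2 with
    | .idle => (P.out s.2.1).map fun o => if i.val = 0 then o else []
    | .partialSum _ => none
    | .merge _ _ => none

/-- The union of the sets of the first `t` machines on the cycle, starting at `i`. -/
def arcUnion (x : Fin M → InputShare) (b : β) (t : ℕ) (i : Fin M) : Finset α :=
  (Finset.range t).biUnion fun u => P.set b (x ((finRotate M ^ u) i))

/-- The part of the sum that machine `i` is responsible for. -/
def chunkSum (x : Fin M → InputShare) (b : β) (i : Fin M) (k : ℕ) : ℕ :=
  if k < chunkSize R M then P.sumResult R x b (i * chunkSize R M + k) else 0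

/-- The states of all machines after `j` rounds of the step that starts with public state `b`. -/
def config (x : Fin M → InputShare) (b : β) : ℕ → Fin M → InputShare × β × Work α
  | 0, i => (x i, b, .idle)
  | j + 1, i => (x i, b, if P.isUnion b then .merge (j + 1) (P.arcUnion x b (2 ^ (j + 1)) i) else
      .partialSum (P.chunkSum R x b i))

variable {P R K enc dec} {x : Fin M → InputShare} {b : β}

/-- The arc of length 2^(k+1) from `i` is the arc of length 2^k from `i` followed by the one that
starts 2^k places further. Arcs may wrap around the cycle, which does no harm to unions. -/
theorem arcUnion_double (k : ℕ) (i : Fin M) :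
    P.arcUnion x b (2 ^ k) i ∪ P.arcUnion x b (2 ^ k) ((finRotate M ^ 2 ^ k) i) =
      P.arcUnion x b (2 ^ (k + 1)) i := by
  ext a
  simp only [arcUnion, Finset.mem_union, Finset.mem_biUnion, Finset.mem_range]
  constructor
  · rintro (⟨u, hu, h⟩ | ⟨u, hu, h⟩)
    · exact ⟨u, by rw [pow_succ]; omega, h⟩
    · exact ⟨u + 2 ^ k, by rw [pow_succ]; omega, by rwa [pow_add, Equiv.Perm.mul_apply]⟩
  · rintro ⟨u, hu, h⟩
    by_cases hk : u < 2 ^ k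
    · exact Or.inl ⟨u, hk, h⟩
    · refine Or.inr ⟨u - 2 ^ k, by rw [pow_succ] at hu; omega, ?_⟩
      rwa [← Equiv.Perm.mul_apply, ← pow_add, Nat.sub_add_cancel (not_lt.1 hk)]

theorem arcUnion_subset (t : ℕ) (i : Fin M) : P.arcUnion x b t i ⊆ P.unionResult x b := by
  intro a ha
  simp only [arcUnion, unionResult, Finset.mem_biUnion] at ha ⊢
  obtain ⟨u, -, h⟩ := ha
  exact ⟨_, Finset.mem_univ _, h⟩

theorem arcUnion_eq {t : ℕ} (ht : M ≤ t) (i : Fin M) :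
    P.arcUnion x b t i = P.unionResult x b := by
  refine (arcUnion_subset t i).antisymm fun a ha => ?_
  simp only [arcUnion, unionResult, Finset.mem_biUnion, Finset.mem_range] at ha ⊢
  obtain ⟨j, -, h⟩ := ha
  obtain ⟨u, hu, rfl⟩ := exists_finRotate_pow_eq i j
  exact ⟨u, hu.trans_le ht, h⟩

theorem arcUnion_one (i : Fin M) : P.arcUnion x b 1 i = P.set b (x i) := by
  simp [arcUnion]

omit [NeZero W] in
-- In each round of a union a machine hears from exactly one other position of the cycle, the one
-- 2^k places ahead.
theorem mem_biUnion_mergeSend {k : ℕ} {Y : Fin M → Finset α}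
    (hdec : ∀ i, ∀ a ∈ Y i, dec (enc a) = a) (i : Fin M) :
    (Finset.univ.biUnion fun j => (mergeSend enc j k (Y j) i).toFinset.image dec) =
      Y ((finRotate M ^ 2 ^ k) i) := by
  ext a
  simp only [Finset.mem_biUnion, Finset.mem_univ, true_and, mergeSend]
  constructor
  · rintro ⟨j, h⟩
    split_ifs at h with hj
    · subst hj
      simp only [Finset.mem_image, List.mem_toFinset, List.mem_map, Finset.mem_toList] at h
      obtain ⟨_, ⟨a', ha', rfl⟩, rfl⟩ := h
      rwa [hdec _ _ ha']
    · simp at h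
  · intro h
    refine ⟨(finRotate M ^ 2 ^ k) i, ?_⟩
    rw [if_pos rfl]
    simp only [Finset.mem_image, List.mem_toFinset, List.mem_map, Finset.mem_toList]
    exact ⟨_, ⟨a, h, rfl⟩, hdec _ _ h⟩

omit [NeZero W] in
theorem afterMerge_mergeSend {k : ℕ} (hK : M ≤ 2 ^ K) (hk : k < K)
    (hdec : ∀ i, ∀ a ∈ P.set b (x i), dec (enc a) = a) (i : Fin M) :
    P.afterMerge K dec (x i) b k (P.arcUnion x b (2 ^ k) i)
        (fun j => mergeSend enc j k (P.arcUnion x b (2 ^ k) j) i) =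
      if k + 1 < K then (x i, b, .merge (k + 1) (P.arcUnion x b (2 ^ (k + 1)) i))
      else (x i, P.nextUnion b (P.unionResult x b), .idle) := by
  have h : ∀ i, ∀ a ∈ P.arcUnion x b (2 ^ k) i, dec (enc a) = a := by
    intro i a ha
    simp only [arcUnion, Finset.mem_biUnion] at ha
    obtain ⟨u, -, h⟩ := ha
    exact hdec _ _ h
  simp only [afterMerge]
  rw [mem_biUnion_mergeSend (Y := fun j => P.arcUnion x b (2 ^ k) j) h i, arcUnion_double]
  split_ifs with hk'
  · rfl
  · rw [show k + 1 = K by omega, arcUnion_eq hK]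

/-- The `M` chunks of length R/M + 1 cover all `R` coordinates, so each coordinate has a responsible
machine. -/
theorem chunk_reassemble {r : ℕ} (hr : r < R) (hM : 0 < M) : r / chunkSize R M < M := by
  rw [Nat.div_lt_iff_lt_mul (show 0 < chunkSize R M from Nat.succ_pos _)]
  have := Nat.div_add_mod R M
  have := Nat.mod_lt R hM
  rw [chunkSize, mul_add]
  omega

theorem output_config (hb : P.out b = none) (j : ℕ) (i : Fin M) :
    (simulate P R K enc dec).output i (config P R x b j i) = none := by
  rcases j with _ | j
  · simp [simulate, config, hb]
  · simp only [simulate, config]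
    by_cases h : P.isUnion b <;> simp [h]

theorem message_config (hb : P.out b = none) (j : ℕ) (i i' : Fin M) :
    (simulate P R K enc dec).message (config P R x b j) i i' =
      (simulate P R K enc dec).send i (config P R x b j i) i' := by
  simp [TypedAlgorithm.message, output_config hb]

theorem send_union (hu : P.isUnion b) (j : ℕ) (i i' : Fin M) :
    (simulate P R K enc dec).send i (config P R x b j i) i' =
      mergeSend enc i j (P.arcUnion x b (2 ^ j) i) i' := by
  rcases j with _ | j
  · simp [simulate, config, hu, arcUnion_one]
  · simp [simulate, config, hu]

theorem round_config_union (hK : M ≤ 2 ^ K) (hb : P.out b = none) (hu : P.isUnion b)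
    (hdec : ∀ i, ∀ a ∈ P.set b (x i), dec (enc a) = a) {j : ℕ} (hj : j < K) :
    (simulate P R K enc dec).round (config P R x b j) =
      if j + 1 < K then config P R x b (j + 1) else config P R x (P.next R x b) 0 := by
  funext i
  simp only [TypedAlgorithm.round, output_config hb, message_config hb, send_union hu]
  have key := afterMerge_mergeSend (P := P) (x := x) (b := b) hK hj hdec i
  have e : (simulate P R K enc dec).update i (config P R x b j i)
      (fun j_1 => mergeSend enc j_1 j (P.arcUnion x b (2 ^ j) j_1) i) =
      P.afterMerge K dec (x i) b j (P.arcUnion x b (2 ^ j) i)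
        (fun j_1 => mergeSend enc j_1 j (P.arcUnion x b (2 ^ j) j_1) i) := by
    rcases j with _ | j
    · simp [simulate, config, hu, arcUnion_one]
    · simp [simulate, config, hu]
  simp only [Option.isSome_none, Bool.false_eq_true, if_false]
  rw [e, key]
  split_ifs <;> simp [config, next, hu]

theorem round_config_sum (hb : P.out b = none) (hu : P.isUnion b = false)
    (hsum : ∀ r < R, ∑ i, P.vec b (x i) r < W) {j : ℕ} (hj : j < 2) :
    (simulate P R K enc dec).round (config P R x b j) =
      if j + 1 < 2 then config P R x b (j + 1) else config P R x (P.next R x b) 0 := by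
  have hW : 0 < W := Nat.pos_of_ne_zero (NeZero.ne W)
  have hres : ∀ r, P.sumResult R x b r < W := by
    intro r
    by_cases hr : r < R
    · simpa [sumResult, coord, hr] using hsum r hr
    · simpa [sumResult, coord, hr] using hW
  -- The bound on the total also bounds each summand, so no reduction modulo `W` takes place when a
  -- coordinate is sent as a word.
  have hco : ∀ i r, P.coord R b (x i) r < W := fun i r =>
    (Finset.single_le_sum (f := fun i => P.coord R b (x i) r) (fun _ _ => Nat.zero_le _)
      (Finset.mem_univ i)).trans_lt (hres r)
  funext i
  simp only [TypedAlgorithm.round, output_config hb, message_config hb, Option.isSome_none,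
    Bool.false_eq_true, if_false]
  rcases (show j = 0 ∨ j = 1 by omega) with rfl | rfl
  · simp only [simulate, config, hu, zero_add, Nat.one_lt_ofNat, if_true, Bool.false_eq_true, if_false]
    congr 3
    funext k
    simp only [chunkSum, sumResult]
    split_ifs with hk
    · refine Finset.sum_congr rfl fun i' _ => ?_
      simp [List.getD_eq_getElem?_getD, hk, Nat.mod_eq_of_lt (hco _ _)]
    · rfl
  · simp only [simulate, config, hu, zero_add, lt_irrefl, Nat.reduceAdd, if_false, next,
      Bool.false_eq_true]
    congr 3
    funext r
    have hM : 0 < M := i.pos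
    have hc : r % chunkSize R M < chunkSize R M := Nat.mod_lt _ (Nat.succ_pos _)
    by_cases hr : r < R
    · rw [dif_pos ⟨hr, chunk_reassemble hr hM⟩]
      simp only [List.getD_eq_getElem?_getD, List.getElem?_map, List.getElem?_range hc,
        Option.map_some, Option.getD_some, chunkSum, if_pos hc, Fin.val_ofNat, Nat.div_add_mod']
      exact Nat.mod_eq_of_lt (hres r)
    · simp [hr, sumResult, coord]

end Simulation

end BoardProtocol

/-! ### Memory, communication and running time of the simulation -/

namespace BoardProtocol

variable {α β : Type} [DecidableEq α] {M W : ℕ}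

/-- Conditions under which the step that starts with the public state `b` can be carried out. -/
structure ValidStep (P : BoardProtocol α β) (R W : ℕ) (U : Set α) (x : Fin M → InputShare)
    (b : β) : Prop where
  out_none : P.out b = none
  sum_lt : P.isUnion b = false → ∀ r < R, ∑ i, P.vec b (x i) r < W
  set_mem : P.isUnion b = true → ∀ i, ∀ a ∈ P.set b (x i), a ∈ U
  card_le : P.isUnion b = true → (P.unionResult x b).card ≤ R

section Storage

variable (R W H K : ℕ) (U : Set α)

/-- The possible results of a step. -/
def validResults : Set ((ℕ → ℕ) ⊕ Finset α) :=
  Sum.inl '' {f : ℕ → ℕ | (∀ r < R, f r < W) ∧ ∀ r, R ≤ r → f r = 0} ∪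
    Sum.inr '' {s : Finset α | (∀ a ∈ s, a ∈ U) ∧ s.card ≤ R}

/-- The public states that are reached by at most `H` steps. -/
def validStates (P : BoardProtocol α β) : Set β :=
  (fun l : List ((ℕ → ℕ) ⊕ Finset α) =>
      l.foldl (fun b r => r.elim (P.nextSum b) (P.nextUnion b)) P.init) ''
    {l | l.length ≤ H ∧ ∀ r ∈ l, r ∈ validResults R W U}

def validWork : Set (Work α) :=
  (Work.partialSum '' {f : ℕ → ℕ | (∀ r < R + 1, f r < W) ∧ ∀ r, R + 1 ≤ r → f r = 0} ∪
    (fun q : ℕ × Finset α => Work.merge q.1 q.2) ''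
      (Set.Iio K ×ˢ {s : Finset α | (∀ a ∈ s, a ∈ U) ∧ s.card ≤ R})) ∪ {Work.idle}

variable {R W H K U}

omit [DecidableEq α] in
theorem fits_validResults (hW : 2 ≤ W) (hU : Fits W U 1) :
    Fits W (validResults R W U) (R + 2) := by
  have : NeZero W := ⟨by omega⟩
  exact (((Fits.vector R).image _).mono (Nat.le_succ R)).union hW ((hU.finset hW R).image _)

omit [DecidableEq α] in
-- The state type is arbitrary, but a state is determined by the results of the steps before it: at
-- most `H` of them, each in R + 2 words plus a tag for the end of the list.
theorem fits_validStates (hW : 2 ≤ W) (hU : Fits W U 1) (P : BoardProtocol α β) :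
    Fits W (validStates R W H U P) (H * (R + 3)) := by
  have : NeZero W := ⟨by omega⟩
  exact ((fits_validResults hW hU).list_le hW H).image _

omit [DecidableEq α] in
theorem fits_validWork (hW : 2 ≤ W) (hKW : K ≤ W) (hU : Fits W U 1) :
    Fits W (validWork R W K U) (R + 4) := by
  -- Partial sums have up to R + 1 entries, since a chunk has length R/M + 1. A merge stores its
  -- round number and a set of at most `R` items; two further tag words tell the three cases apart.
  have : NeZero W := ⟨by omega⟩
  have h1 : Fits W (Set.Iio K) 1 :=
    Fits.of_lt id (Set.injOn_id _) fun k hk => (Set.mem_Iio.1 hk).trans_le hKW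
  have h2 := ((h1.prod (hU.finset hW R)).mono (show 1 + (R + 1) ≤ R + 2 by omega)).image
    fun q : ℕ × Finset α => Work.merge q.1 q.2
  have h3 : Fits W ((Work.partialSum : (ℕ → ℕ) → Work α) ''
      {f : ℕ → ℕ | (∀ r < R + 1, f r < W) ∧ ∀ r, R + 1 ≤ r → f r = 0}) (R + 2) :=
    ((Fits.vector (R + 1)).image _).mono (Nat.le_succ _)
  exact (h3.union hW h2).union hW (Fits.singleton _)

omit [DecidableEq α] in
theorem sumResult_lt {P : BoardProtocol α β} {x : Fin M → InputShare} {b : β}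
    (hW : 0 < W) (h : ∀ r < R, ∑ i, P.vec b (x i) r < W) (r : ℕ) : P.sumResult R x b r < W := by
  by_cases hr : r < R
  · simpa [sumResult, coord, hr] using h r hr
  · simpa [sumResult, coord, hr] using hW

theorem ValidStep.unionResult_mem {P : BoardProtocol α β} {x : Fin M → InputShare} {b : β}
    (h : P.ValidStep R W U x b) (hu : P.isUnion b = true) : ∀ a ∈ P.unionResult x b, a ∈ U := by
  intro a ha
  simp only [unionResult, Finset.mem_biUnion] at ha
  obtain ⟨i, -, ha⟩ := ha
  exact h.set_mem hu i a ha

theorem state_mem_validStates {P : BoardProtocol α β} {x : Fin M → InputShare} (hW : 0 < W)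
    {k : ℕ} (hk : k ≤ H) (hv : ∀ j < k, P.ValidStep R W U x (P.state R x j)) :
    P.state R x k ∈ validStates R W H U P := by
  have key : ∀ m ≤ k, ∃ l : List ((ℕ → ℕ) ⊕ Finset α), l.length = m ∧
      (∀ r ∈ l, r ∈ validResults R W U) ∧
      l.foldl (fun b r => r.elim (P.nextSum b) (P.nextUnion b)) P.init = P.state R x m := by
    intro m
    induction m with
    | zero => exact fun _ => ⟨[], rfl, by simp, rfl⟩
    | succ m ih =>
      intro hm
      obtain ⟨l, hl, hl', hl''⟩ := ih (by omega)
      have h := hv m (by omega)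
      by_cases hu : P.isUnion (P.state R x m)
      · refine ⟨l ++ [.inr (P.unionResult x (P.state R x m))], by simp [hl], ?_, ?_⟩
        · intro r hr
          rcases List.mem_append.1 hr with hr | hr
          · exact hl' r hr
          · rw [List.mem_singleton.1 hr]
            exact Or.inr ⟨_, ⟨h.unionResult_mem hu, h.card_le hu⟩, rfl⟩
        · simp [hl'', state_succ, next, hu]
      · rw [Bool.not_eq_true] at hu
        refine ⟨l ++ [.inl (P.sumResult R x (P.state R x m))], by simp [hl], ?_, ?_⟩
        · intro r hr
          rcases List.mem_append.1 hr with hr | hr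
          · exact hl' r hr
          · rw [List.mem_singleton.1 hr]
            refine Or.inl ⟨_, ⟨fun r _ => sumResult_lt hW (h.sum_lt hu) r, fun r hr => ?_⟩, rfl⟩
            simp [sumResult, coord, not_lt.2 hr]
        · simp [hl'', state_succ, next, hu]
  obtain ⟨l, hl, hl', hl''⟩ := key k le_rfl
  exact ⟨l, ⟨hl ▸ hk, hl'⟩, hl''⟩

end Storage

section Run

variable {P : BoardProtocol α β} {R K : ℕ} [NeZero W] {enc : α → Fin W} {dec : Fin W → α}
  {x : Fin M → InputShare} {b : β} {U : Set α}

theorem round_config (hK : M ≤ 2 ^ K) (hU : ∀ a ∈ U, dec (enc a) = a)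
    (hb : P.ValidStep R W U x b) {j : ℕ} (hj : j < P.cost K b) :
    (simulate P R K enc dec).round (config P R x b j) =
      if j + 1 < P.cost K b then config P R x b (j + 1) else config P R x (P.next R x b) 0 := by
  by_cases hu : P.isUnion b
  · simp only [cost, hu, if_true] at hj ⊢
    exact round_config_union hK hb.out_none hu (fun i a ha => hU a (hb.set_mem hu i a ha)) hj
  · rw [Bool.not_eq_true] at hu
    simp only [cost, hu, Bool.false_eq_true, if_false] at hj ⊢
    exact round_config_sum hb.out_none hu (hb.sum_lt hu) hj

theorem round_config_done {o : List (ℕ × ℕ)} (hb : P.out b = some o) :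
    (simulate P R K enc dec).round (config P R x b 0) = config P R x b 0 := by
  funext i
  simp [TypedAlgorithm.round, simulate, config, hb]

theorem message_config_done {o : List (ℕ × ℕ)} (hb : P.out b = some o) (i j : Fin M) :
    (simulate P R K enc dec).message (config P R x b 0) i j = [] := by
  simp [TypedAlgorithm.message, simulate, config, hb]

variable {kf : ℕ} {o : List (ℕ × ℕ)}

theorem run_succ (t : ℕ) : (simulate P R K enc dec).run x (t + 1) =
    (simulate P R K enc dec).round ((simulate P R K enc dec).run x t) :=
  Function.iterate_succ_apply' _ _ _

omit [DecidableEq α] in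
theorem cost_pos (hKpos : 0 < K) : 0 < P.cost K b := by
  unfold cost
  split_ifs <;> omega

theorem run_sum_cost (hK : M ≤ 2 ^ K) (hKpos : 0 < K) (hU : ∀ a ∈ U, dec (enc a) = a)
    (hv : ∀ k < kf, P.ValidStep R W U x (P.state R x k)) :
    ∀ k ≤ kf, (simulate P R K enc dec).run x (∑ m ∈ Finset.range k, P.cost K (P.state R x m)) =
      config P R x (P.state R x k) 0 := by
  intro k
  induction k with
  | zero => exact fun _ => rfl
  | succ k ih =>
    intro hk
    have hc := cost_pos (P := P) (b := P.state R x k) hKpos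
    have key : ∀ j < P.cost K (P.state R x k),
        (simulate P R K enc dec).run x (∑ m ∈ Finset.range k, P.cost K (P.state R x m) + j) =
          config P R x (P.state R x k) j := by
      intro j
      induction j with
      | zero => exact fun _ => ih (by omega)
      | succ j ihj =>
        intro hj
        rw [← add_assoc, run_succ, ihj (by omega), round_config hK hU (hv k hk) (by omega), if_pos hj]
    obtain ⟨j, hj⟩ : ∃ j, P.cost K (P.state R x k) = j + 1 := ⟨_, (Nat.succ_pred_eq_of_pos hc).symm⟩
    rw [Finset.sum_range_succ, hj, ← add_assoc, run_succ, key j (by omega),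
      round_config hK hU (hv k hk) (by omega), if_neg (by omega), state_succ]

/-- The memory bound is demanded at all times, also after termination, so every configuration of the
run has to be identified, not only those at the ends of steps. -/
theorem run_cases (hK : M ≤ 2 ^ K) (hKpos : 0 < K) (hU : ∀ a ∈ U, dec (enc a) = a)
    (hv : ∀ k < kf, P.ValidStep R W U x (P.state R x k)) (ho : P.out (P.state R x kf) = some o)
    (t : ℕ) :
    (∃ k < kf, ∃ j < P.cost K (P.state R x k),
      (simulate P R K enc dec).run x t = config P R x (P.state R x k) j) ∨
    (simulate P R K enc dec).run x t = config P R x (P.state R x kf) 0 := by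
  induction t with
  | zero =>
    rcases Nat.eq_zero_or_pos kf with rfl | hkf
    · exact Or.inr rfl
    · exact Or.inl ⟨0, hkf, 0, cost_pos hKpos, rfl⟩
  | succ t ih =>
    rw [run_succ]
    rcases ih with ⟨k, hk, j, hj, h⟩ | h
    · rw [h, round_config hK hU (hv k hk) hj]
      split_ifs with hj'
      · exact Or.inl ⟨k, hk, j + 1, hj', rfl⟩
      · rw [← state_succ]
        rcases Nat.lt_or_ge (k + 1) kf with hk' | hk'
        · exact Or.inl ⟨k + 1, hk', 0, cost_pos hKpos, rfl⟩
        · exact Or.inr (by rw [show k + 1 = kf by omega])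
    · exact Or.inr (by rw [h, round_config_done ho])

omit [NeZero W] in
theorem card_arcUnion_le (hb : P.ValidStep R W U x b) (hu : P.isUnion b = true) (t : ℕ)
    (i : Fin M) : (P.arcUnion x b t i).card ≤ R :=
  (Finset.card_le_card (arcUnion_subset t i)).trans (hb.card_le hu)

/-- In a union a machine has a single addressee and sends part of a set of at most `R` items; in a
sum it sends M chunks, at most R + M words together. -/
theorem sum_send_config_le (hb : P.ValidStep R W U x b) (j : ℕ) (i : Fin M) :
    ∑ i', ((simulate P R K enc dec).message (config P R x b j) i i').length ≤ R + M := by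
  simp only [message_config hb.out_none]
  by_cases hu : P.isUnion b
  · simp only [send_union hu, mergeSend, ← Equiv.eq_symm_apply, apply_ite List.length]
    simpa using (card_arcUnion_le hb hu _ i).trans (Nat.le_add_right _ _)
  · have h : ∀ i', ((simulate P R K enc dec).send i (config P R x b j i) i').length =
        chunkSize R M := by
      intro i'
      rcases j with _ | j <;> simp [simulate, config, hu]
    simp only [h, Finset.sum_const, Finset.card_univ, Fintype.card_fin, smul_eq_mul, chunkSize,
      mul_add, mul_one]
    exact Nat.add_le_add_right (Nat.mul_div_le R M) M

theorem sum_receive_config_le (hb : P.ValidStep R W U x b) (j : ℕ) (i : Fin M) :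
    ∑ i', ((simulate P R K enc dec).message (config P R x b j) i' i).length ≤ R + M := by
  simp only [message_config hb.out_none]
  by_cases hu : P.isUnion b
  · simp only [send_union hu, mergeSend, apply_ite List.length]
    simpa using (card_arcUnion_le hb hu _ _).trans (Nat.le_add_right _ _)
  · have h : ∀ i', ((simulate P R K enc dec).send i' (config P R x b j i') i).length =
        chunkSize R M := by
      intro i'
      rcases j with _ | j <;> simp [simulate, config, hu]
    simp only [h, Finset.sum_const, Finset.card_univ, Fintype.card_fin, smul_eq_mul, chunkSize,
      mul_add, mul_one]
    exact Nat.add_le_add_right (Nat.mul_div_le R M) M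

theorem config_work_mem (hb : P.ValidStep R W U x b) {j : ℕ} (hj : j < P.cost K b) (i : Fin M) :
    (config P R x b j i).2.2 ∈ validWork R W K U := by
  have hW : 0 < W := Nat.pos_of_ne_zero (NeZero.ne W)
  rcases j with _ | j
  · exact Or.inr rfl
  · by_cases hu : P.isUnion b
    · simp only [cost, hu, if_true] at hj
      simp only [config, hu, if_true]
      exact Or.inl (Or.inr ⟨(j + 1, P.arcUnion x b (2 ^ (j + 1)) i), ⟨hj,
        fun a ha => hb.unionResult_mem hu a (arcUnion_subset _ i ha),
        card_arcUnion_le hb hu _ i⟩, rfl⟩)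
    · rw [Bool.not_eq_true] at hu
      simp only [config, hu, Bool.false_eq_true, if_false]
      refine Or.inl (Or.inl ⟨_, ⟨fun r _ => ?_, fun r hr => ?_⟩, rfl⟩)
      · unfold chunkSum
        split_ifs
        · exact sumResult_lt hW (hb.sum_lt hu) _
        · exact hW
      · unfold chunkSum chunkSize
        rw [if_neg]
        have := Nat.div_le_self R M
        omega

end Run

/-- A board protocol whose steps are valid yields an algorithm for machines with `S` words. -/
theorem exists_mpcAlgorithm (P : BoardProtocol α β) {R W H K S : ℕ} {U : Set α} {X : Set InputShare}
    [Nonempty α] {w : ℕ} (hW : 2 ≤ W) (hKW : K ≤ W) (hKpos : 0 < K) (hK : M ≤ 2 ^ K)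
    (hU : Fits W U 1) (hX : Fits W X w) (hS : w + H * (R + 3) + (R + 4) ≤ S) (hRM : R + M ≤ S) :
    ∃ A : MPCAlgorithm M W, ∀ (n C : ℕ) (I : ListColoringInstance n C)
      (D : InputDistribution I M S) (kf : ℕ) (o : List (ℕ × ℕ)) (φ : Fin n → ℕ),
      (∀ i, D.share i ∈ X) → kf ≤ H →
      (∀ k < kf, P.ValidStep R W U D.share (P.state R D.share k)) →
      P.out (P.state R D.share kf) = some o → 2 * o.length ≤ S → 0 < M →
      I.IsListColoring φ →
      (o : Multiset (ℕ × ℕ)) = (Finset.univ.val.map fun v => (I.ident v, φ v)) →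
      A.SolvesIn D (∑ k ∈ Finset.range kf, P.cost K (P.state R D.share k)) := by
  have : NeZero W := ⟨by omega⟩
  obtain ⟨enc, dec, hdec⟩ := hU.exists_word
  have hV := (hX.prod ((fits_validStates (H := H) (R := R) hW hU P).prod
    (fits_validWork (R := R) hW hKW hU))).mono (show _ ≤ S by omega)
  have : Nonempty (InputShare × β × Work α) := ⟨⟨⟨∅, ∅⟩, P.init, .idle⟩⟩
  obtain ⟨encV, decV, hlen, hdecV⟩ := hV.exists_code
  refine ⟨(simulate P R K enc dec).encode encV decV, ?_⟩
  intro n C I D kf o φ hshare hkf hv ho hoS hM hφ hsum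
  have hrun := run_cases (K := K) hK hKpos hdec hv ho
  have hstate : ∀ k ≤ kf, P.state R D.share k ∈ validStates R W H U P := fun k hk =>
    state_mem_validStates (by omega) (hk.trans hkf) fun j hj => hv j (by omega)
  refine TypedAlgorithm.encode_solvesIn (fun s => (hlen s).le) (fun t i => hdecV _ ?_)
    (fun t i => ?_) (fun t i => ?_) (fun t i o' ho' => ?_)
    (fun i => if i.val = 0 then o else []) φ (fun i => ?_) hφ ?_
  · have h1 : ∀ b j, (config P R D.share b j i).1 = D.share i := by
      intro b j; cases j <;> rfl
    have h2 : ∀ b j, (config P R D.share b j i).2.1 = b := by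
      intro b j; cases j <;> rfl
    rcases hrun t with ⟨k, hk, j, hj, h⟩ | h
    · rw [h]
      refine ⟨by rw [h1]; exact hshare i, ?_, config_work_mem (hv k hk) hj i⟩
      rw [h2]; exact hstate k hk.le
    · rw [h]
      exact ⟨hshare i, hstate kf le_rfl, Or.inr rfl⟩
  · rcases hrun t with ⟨k, hk, j, hj, h⟩ | h
    · rw [h]
      exact (sum_send_config_le (hv k hk) j i).trans hRM
    · simp [h, message_config_done ho]
  · rcases hrun t with ⟨k, hk, j, hj, h⟩ | h
    · rw [h]
      exact (sum_receive_config_le (hv k hk) j i).trans hRM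
    · simp [h, message_config_done ho]
  · rcases hrun t with ⟨k, hk, j, hj, h⟩ | h
    · rw [h, output_config (hv k hk).out_none] at ho'
      simp at ho'
    · rw [h] at ho'
      simp only [simulate, config, ho, Option.map_some, Option.mem_def, Option.some.injEq] at ho'
      subst ho'
      split_ifs
      · exact hoS
      · simp
  · rw [run_sum_cost hK hKpos hdec hv kf le_rfl]
    simp [simulate, config, ho]
  · rw [← hsum, Finset.sum_eq_single (⟨0, hM⟩ : Fin M)]
    · simp
    · intro i _ hi
      have : i.val ≠ 0 := fun h => hi (Fin.ext h)
      simp [this]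
    · simp

end BoardProtocol

/-! ### Pairwise independent hashing and biased bits -/

/-- The affine hash function with seed `(a, b)` modulo `q`. -/
def affineHash (q a b x : ℕ) : ℕ := (a * x + b) % q

/-- Affine hash functions modulo a prime are pairwise independent. -/
theorem sum_affineHash {q x y : ℕ} (hq : q.Prime) (hx : x < q) (hy : y < q) (hxy : x ≠ y)
    (F : ℕ → ℕ → ℕ) :
    ∑ a ∈ Finset.range q, ∑ b ∈ Finset.range q, F (affineHash q a b x) (affineHash q a b y) =
      ∑ c ∈ Finset.range q, ∑ d ∈ Finset.range q, F c d := by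
  have : Fact q.Prime := ⟨hq⟩
  rw [← Finset.sum_product', ← Finset.sum_product']
  have hmaps : Set.MapsTo (fun p : ℕ × ℕ => (affineHash q p.1 p.2 x, affineHash q p.1 p.2 y))
      ↑(Finset.range q ×ˢ Finset.range q) ↑(Finset.range q ×ˢ Finset.range q) := by
    rintro ⟨a, b⟩ -
    simp [affineHash, Nat.mod_lt _ hq.pos]
  have hinj : Set.InjOn (fun p : ℕ × ℕ => (affineHash q p.1 p.2 x, affineHash q p.1 p.2 y))
      ↑(Finset.range q ×ˢ Finset.range q) := by
    rintro ⟨a, b⟩ hab ⟨a', b'⟩ hab' h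
    simp only [Finset.coe_product, Finset.coe_range, Set.mem_prod, Set.mem_Iio] at hab hab'
    simp only [affineHash, Prod.mk.injEq] at h
    have h1 : ((a * x + b : ℕ) : ZMod q) = ((a' * x + b' : ℕ) : ZMod q) :=
      (ZMod.natCast_eq_natCast_iff _ _ _).2 h.1
    have h2 : ((a * y + b : ℕ) : ZMod q) = ((a' * y + b' : ℕ) : ZMod q) :=
      (ZMod.natCast_eq_natCast_iff _ _ _).2 h.2
    push_cast at h1 h2
    have hne : (x : ZMod q) - y ≠ 0 := by
      rw [sub_ne_zero]
      intro h
      rw [ZMod.natCast_eq_natCast_iff] at h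
      exact hxy (Nat.ModEq.eq_of_lt_of_lt h hx hy)
    have h3 : ((a : ZMod q) - a') * (x - y) = 0 := by linear_combination h1 - h2
    have h4 : (a : ZMod q) = a' := sub_eq_zero.1 ((mul_eq_zero.1 h3).resolve_right hne)
    have h5 : (b : ZMod q) = b' := by linear_combination h1 - x * h4
    rw [ZMod.natCast_eq_natCast_iff] at h4 h5
    rw [Nat.ModEq.eq_of_lt_of_lt h4 hab.1 hab'.1, Nat.ModEq.eq_of_lt_of_lt h5 hab.2 hab'.2]
  exact Finset.sum_nbij _ hmaps hinj (Finset.surjOn_of_injOn_of_card_le _ hmaps hinj le_rfl)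
    fun _ _ => rfl

/-- The number of hash values for which the next bit is `0`, when there is slack `z₀` for the bit
`0` and slack `z₁` for the bit `1`. -/
def threshold (q : ℕ) (z : ℕ → ℕ) : ℕ := q * z 0 / (z 0 + z 1)

/-- The bit chosen by a node with hash value `h`. -/
def chosenBit (q : ℕ) (z : ℕ → ℕ) (h : ℕ) : ℕ := if h < threshold q z then 0 else 1

/-- The integral weight of a node with slack `s`. -/
def weight (q s : ℕ) : ℕ := q / s + 1

theorem le_weight_mul {q s : ℕ} (hs : 0 < s) : q ≤ weight q s * s := by
  have := Nat.div_add_mod q s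
  have := Nat.mod_lt q hs
  rw [weight, add_mul, one_mul, mul_comm]
  omega

theorem weight_mul_le (q s : ℕ) : weight q s * s ≤ q + s := by
  rw [weight, add_mul, one_mul]
  exact Nat.add_le_add_right (Nat.div_mul_le_self q s) s

theorem weight_anti {q s s' : ℕ} (hs : 0 < s) (h : s ≤ s') : weight q s' ≤ weight q s :=
  Nat.add_le_add_right (Nat.div_le_div_left h hs) 1

theorem weight_le (q s : ℕ) : weight q s ≤ q + 1 := Nat.add_le_add_right (Nat.div_le_self q s) 1

/-- This is the identity (z/s)·(1/z) = 1/s with rounding: `t` of the `q` hash values select the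
extension with slack `z`, and `weight q` replaces q divided by the slack. The rounding of the
probability and that of the weight each cost a factor 1 + n/q. -/
theorem mul_weight_le {q n t z s : ℕ} (hs : 0 < s) (hz : z ≤ n) (ht : t * s ≤ z * (q + n)) :
    t * weight q z * q ≤ (q + n) ^ 2 * weight q s := by
  calc t * weight q z * q ≤ t * weight q z * (weight q s * s) :=
        Nat.mul_le_mul_left _ (le_weight_mul hs)
    _ = (t * s) * weight q z * weight q s := by ring
    _ ≤ (z * (q + n)) * weight q z * weight q s := by gcongr
    _ = (weight q z * z) * (q + n) * weight q s := by ring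
    _ ≤ (q + n) * (q + n) * weight q s := by
        gcongr
        exact (weight_mul_le q z).trans (Nat.add_le_add_left hz q)
    _ = (q + n) ^ 2 * weight q s := by ring

theorem threshold_le {q : ℕ} {z : ℕ → ℕ} : threshold q z ≤ q := by
  unfold threshold
  rcases Nat.eq_zero_or_pos (z 0 + z 1) with h | h
  · simp [h]
  · rw [Nat.div_le_iff_le_mul_add_pred h, mul_comm]
    exact (Nat.mul_le_mul_right q (Nat.le_add_right _ _)).trans (Nat.le_add_right _ _)

theorem threshold_mul_le {q n : ℕ} {z : ℕ → ℕ} :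
    threshold q z * (z 0 + z 1) ≤ z 0 * (q + n) :=
  (Nat.div_mul_le_self _ _).trans (by rw [mul_comm]; gcongr; omega)

/-- Rounding down the threshold favors bit `1` by a remainder below z 0 + z 1 ≤ n. If z 1 > 0 this
is absorbed in z 1 · n; if z 1 = 0 the threshold equals `q` exactly. -/
theorem sub_threshold_mul_le {q n : ℕ} {z : ℕ → ℕ} (hs : 0 < z 0 + z 1) (hn : z 0 + z 1 ≤ n) :
    (q - threshold q z) * (z 0 + z 1) ≤ z 1 * (q + n) := by
  rcases Nat.eq_zero_or_pos (z 1) with h | h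
  · simp [threshold, h, Nat.mul_div_cancel q (show 0 < z 0 by omega)]
  · have h1 := Nat.div_add_mod (q * z 0) (z 0 + z 1)
    have h2 := Nat.mod_lt (q * z 0) hs
    have h3 : n ≤ z 1 * n := Nat.le_mul_of_pos_left n h
    rw [Nat.sub_mul, threshold, mul_comm (q * z 0 / _)]
    rw [Nat.sub_le_iff_le_add, mul_add, mul_add, mul_comm (z 1) q]
    omega

/-- The threshold is 0 when z 0 = 0 and `q` when z 1 = 0, so despite rounding no hash value selects
a bit without slack. -/
theorem slack_chosenBit_pos {q h : ℕ} {z : ℕ → ℕ} (hh : h < q) (hs : 0 < z 0 + z 1) :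
    0 < z (chosenBit q z h) := by
  unfold chosenBit
  split_ifs with ht
  · by_contra h0
    have h0 : z 0 = 0 := by omega
    simp [threshold, h0] at ht
  · by_contra h0
    have h0 : z 1 = 0 := by omega
    simp [threshold, h0, Nat.mul_div_cancel q (show 0 < z 0 by omega)] at ht
    omega

theorem chosenBit_le_one (q : ℕ) (z : ℕ → ℕ) (h : ℕ) : chosenBit q z h = 0 ∨ chosenBit q z h = 1 := by
  unfold chosenBit
  split_ifs <;> simp

theorem sum_range_ite_lt {q t : ℕ} (ht : t ≤ q) (A B : ℕ) :
    ∑ c ∈ Finset.range q, (if c < t then A else B) = t * A + (q - t) * B := by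
  have h1 : (Finset.range q).filter (· < t) = Finset.range t := by
    ext c; simp; omega
  have h2 : (Finset.range q).filter (fun c => ¬ c < t) = Finset.Ico t q := by
    ext c; simp; omega
  rw [Finset.sum_ite, h1, h2]
  simp

/-- The expected weight of a potential conflict does not grow much in one step. -/
theorem sum_conflict_weight_le {q n x y : ℕ} (hq : q.Prime) (hx : x < q) (hy : y < q) (hxy : x ≠ y)
    {z z' : ℕ → ℕ} (hs : 0 < z 0 + z 1) (hn : z 0 + z 1 ≤ n) :
    ∑ a ∈ Finset.range q, ∑ b ∈ Finset.range q,
      (if chosenBit q z' (affineHash q a b y) = chosenBit q z (affineHash q a b x)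
        then weight q (z (chosenBit q z (affineHash q a b x))) else 0) ≤
      (q + n) ^ 2 * weight q (z 0 + z 1) := by
  rw [sum_affineHash hq hx hy hxy fun c d =>
    if chosenBit q z' d = chosenBit q z c then weight q (z (chosenBit q z c)) else 0]
  -- With the hash value `c` of the first node fixed, the number of values `d` of the other node
  -- that give the same bit is `threshold q z'` or its complement.
  have h1 : ∀ c, ∑ d ∈ Finset.range q,
      (if chosenBit q z' d = chosenBit q z c then weight q (z (chosenBit q z c)) else 0) =
      if c < threshold q z then threshold q z' * weight q (z 0)
      else (q - threshold q z') * weight q (z 1) := by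
    intro c
    by_cases hc : c < threshold q z
    · rw [if_pos hc]
      have := sum_range_ite_lt (threshold_le (q := q) (z := z')) (weight q (z 0)) 0
      rw [mul_zero, add_zero] at this
      rw [← this]
      refine Finset.sum_congr rfl fun d _ => ?_
      simp only [chosenBit, hc, if_true]
      split_ifs <;> simp_all
    · rw [if_neg hc]
      have := sum_range_ite_lt (threshold_le (q := q) (z := z')) 0 (weight q (z 1))
      rw [mul_zero, zero_add] at this
      rw [← this]
      refine Finset.sum_congr rfl fun d _ => ?_
      simp only [chosenBit, hc, if_false]
      split_ifs <;> simp_all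
  simp only [h1]
  rw [sum_range_ite_lt threshold_le]
  refine Nat.le_of_mul_le_mul_right ?_ hq.pos
  have e0 := mul_weight_le (q := q) (n := n) hs (show z 0 ≤ n by omega) threshold_mul_le
  have e1 := mul_weight_le (q := q) (n := n) hs (show z 1 ≤ n by omega) (sub_threshold_mul_le hs hn)
  calc _ = threshold q z' * (threshold q z * weight q (z 0) * q) +
        (q - threshold q z') * ((q - threshold q z) * weight q (z 1) * q) := by ring
    _ ≤ threshold q z' * ((q + n) ^ 2 * weight q (z 0 + z 1)) +
        (q - threshold q z') * ((q + n) ^ 2 * weight q (z 0 + z 1)) := by gcongr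
    _ = (threshold q z' + (q - threshold q z')) * ((q + n) ^ 2 * weight q (z 0 + z 1)) := by ring
    _ = _ := by rw [Nat.add_sub_cancel' threshold_le]; ring

open Classical in
/-- An index below `q` at which `f` is minimal. -/
noncomputable def argMin (q : ℕ) (f : ℕ → ℕ) : ℕ :=
  if h : ∃ r < q, ∀ r' < q, f r ≤ f r' then h.choose else 0

theorem argMin_spec {q : ℕ} (hq : 0 < q) (f : ℕ → ℕ) :
    argMin q f < q ∧ ∀ r < q, f (argMin q f) ≤ f r := by
  have h : ∃ r < q, ∀ r' < q, f r ≤ f r' := by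
    obtain ⟨r, hr, h⟩ := Finset.exists_min_image (Finset.range q) f ⟨0, by simpa using hq⟩
    exact ⟨r, by simpa using hr, fun r' hr' => h r' (by simpa using hr')⟩
  rw [argMin, dif_pos h]
  exact h.choose_spec

/-- The minimum is at most the average: the derandomization step. -/
theorem mul_argMin_le {q : ℕ} (hq : 0 < q) (f : ℕ → ℕ) :
    q * f (argMin q f) ≤ ∑ r ∈ Finset.range q, f r := by
  have := Finset.card_nsmul_le_sum (Finset.range q) f (f (argMin q f))
    fun r hr => (argMin_spec hq f).2 r (by simpa using hr)
  simpa using this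

/-- Bernoulli's inequality for (q/(q + n))^m = (1 − n/(q + n))^m, which is at least 1 − mn/(q + n) ≥
2/3. It bounds the accumulated rounding loss by 3/2. -/
theorem two_mul_add_pow_le {q n m : ℕ} (hq : 0 < q) (h : 3 * m * n ≤ q) :
    2 * (q + n) ^ m ≤ 3 * q ^ m := by
  have hq' : (0 : ℝ) < q := by exact_mod_cast hq
  have h' : (3 * m * n : ℝ) ≤ q := by exact_mod_cast h
  have hb := one_add_mul_le_pow (a := -(n / (q + n) : ℝ)) (by
    have : (n / (q + n) : ℝ) ≤ 1 := div_le_one_of_le₀ (by linarith) (by positivity)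
    linarith) m
  have e : (1 + -(n / (q + n) : ℝ)) = q / (q + n) := by field_simp; ring
  rw [e, div_pow, le_div_iff₀ (by positivity)] at hb
  have h2 : (2 / 3 : ℝ) ≤ 1 + m * -(n / (q + n) : ℝ) := by
    have : (m * (n / (q + n)) : ℝ) ≤ 1 / 3 := by
      rw [← mul_div_assoc, div_le_div_iff₀ (by positivity) (by norm_num)]
      have : (0 : ℝ) ≤ n := by positivity
      linarith
    linarith
  have h3 : (2 / 3 : ℝ) * (q + n) ^ m ≤ q ^ m :=
    (mul_le_mul_of_nonneg_right h2 (by positivity)).trans hb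
  have h4 : (2 * (q + n) ^ m : ℝ) ≤ 3 * q ^ m := by linarith
  exact_mod_cast h4

/-! ### Partial colorings, the potential and the progress of a phase -/

namespace ListColoringInstance

variable {n C : ℕ} (I : ListColoringInstance n C) (col : Fin n → Option ℕ)

/-- A proper coloring of some of the nodes with colors from their lists. -/
def IsPartialColoring : Prop :=
  (∀ v k, col v = some k → k ∈ I.L v) ∧ ∀ u v, I.G.Adj u v → ∀ k, col u = some k → col v ≠ some k

def uncolored : Finset (Fin n) := Finset.univ.filter fun v => col v = none

/-- The number of colors in the list of `v` that have the prefix `c`, when the last `ℓ` bits are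
dropped. -/
def colorCount (ℓ c : ℕ) (v : Fin n) : ℕ := ((I.L v).filter fun k => k / 2 ^ ℓ = c).card

open Classical in
/-- The number of neighbors of `v` with a color that has the prefix `c`. -/
noncomputable def nbrColorCount (ℓ c : ℕ) (v : Fin n) : ℕ :=
  ((I.G.neighborFinset v).filter fun w => ∃ k, col w = some k ∧ k / 2 ^ ℓ = c).card

/-- The subtraction is truncated. Hence the slacks of the two extensions may add up to more than the
slack of the prefix; only the lower bound on their sum is needed. -/
noncomputable def slack (ℓ c : ℕ) (v : Fin n) : ℕ := I.colorCount ℓ c v - I.nbrColorCount col ℓ c v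

/-- The uncolored neighbors of `u` with the same value of `pre`. -/
def rivals (pre : Fin n → ℕ) (u : Fin n) : Finset (Fin n) :=
  (I.G.neighborFinset u).filter fun w => col w = none ∧ pre w = pre u

/-- The total weight of the potential conflicts. -/
def potential (q : ℕ) (pre s : Fin n → ℕ) : ℕ :=
  ∑ u ∈ uncolored col, weight q (s u) * (I.rivals col pre u).card

/-- The situation after `m` bits of all candidate colors have been chosen, when `ℓ` bits are left. -/
def PrefixInvariant (q ℓ m : ℕ) (pre : Fin n → ℕ) : Prop :=
  ∃ s : Fin n → ℕ,
    (∀ v ∈ uncolored col, 0 < s v ∧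
      s v + I.nbrColorCount col ℓ (pre v) v ≤ I.colorCount ℓ (pre v) v) ∧
    I.potential col q pre s * q ^ (2 * m) ≤ (q + n) ^ (2 * m) * ((uncolored col).card * (q + n))

variable {I col}

theorem mem_uncolored {v : Fin n} : v ∈ uncolored col ↔ col v = none := by simp [uncolored]

theorem div_two_pow_succ_eq (k ℓ c : ℕ) :
    k / 2 ^ (ℓ + 1) = c ↔ k / 2 ^ ℓ = 2 * c ∨ k / 2 ^ ℓ = 2 * c + 1 := by
  rw [pow_succ, ← Nat.div_div_eq_div_mul]
  omega

theorem colorCount_succ (ℓ c : ℕ) (v : Fin n) :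
    I.colorCount (ℓ + 1) c v = I.colorCount ℓ (2 * c) v + I.colorCount ℓ (2 * c + 1) v := by
  unfold colorCount
  rw [← Finset.card_union_of_disjoint, ← Finset.filter_or]
  · simp only [div_two_pow_succ_eq]
  · exact Finset.disjoint_filter.2 fun k _ h1 h2 => by omega

theorem nbrColorCount_succ (ℓ c : ℕ) (v : Fin n) :
    I.nbrColorCount col (ℓ + 1) c v =
      I.nbrColorCount col ℓ (2 * c) v + I.nbrColorCount col ℓ (2 * c + 1) v := by
  classical
  unfold nbrColorCount
  rw [← Finset.card_union_of_disjoint, ← Finset.filter_or]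
  · congr 1
    refine Finset.filter_congr fun w _ => ?_
    simp only [div_two_pow_succ_eq]
    grind
  · refine Finset.disjoint_filter.2 fun w _ h1 h2 => ?_
    obtain ⟨k, hk, h1⟩ := h1
    obtain ⟨k', hk', h2⟩ := h2
    rw [hk] at hk'
    cases hk'
    omega

theorem colorCount_le (ℓ c : ℕ) (v : Fin n) : I.colorCount ℓ c v ≤ n := by
  refine (Finset.card_filter_le _ _).trans ?_
  rw [I.card_L]
  have := I.G.degree_lt_card_verts v
  simpa using this

theorem colorCount_top {B : ℕ} (hB : C ≤ 2 ^ B) (v : Fin n) :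
    I.colorCount B 0 v = I.G.degree v + 1 := by
  rw [colorCount, Finset.filter_true_of_mem, I.card_L]
  intro k hk
  exact Nat.div_eq_of_lt ((Finset.mem_range.1 (I.L_subset v hk)).trans_le hB)

/-- The witness for the slack is the number of rivals plus one: uncolored and colored neighbors
together number at most deg, and the list has deg + 1 colors. A term of the potential is then at
most `weight q s * s`, hence at most q + n. -/
theorem prefixInvariant_top {B q : ℕ} (hB : C ≤ 2 ^ B) :
    I.PrefixInvariant col q B 0 fun _ => 0 := by
  classical
  have hU : ∀ v, (I.rivals col (fun _ => 0) v).card + I.nbrColorCount col B 0 v ≤ I.G.degree v := by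
    intro v
    rw [rivals, nbrColorCount, ← I.G.card_neighborFinset_eq_degree, ← Finset.card_union_of_disjoint]
    · exact Finset.card_le_card (Finset.union_subset (Finset.filter_subset _ _)
        (Finset.filter_subset _ _))
    · refine Finset.disjoint_filter.2 fun w _ h1 h2 => ?_
      obtain ⟨k, hk, -⟩ := h2
      rw [h1.1] at hk
      cases hk
  refine ⟨fun v => (I.rivals col (fun _ => 0) v).card + 1, fun v _ => ⟨Nat.succ_pos _, ?_⟩, ?_⟩
  · have := hU v
    simp only [colorCount_top hB]
    omega
  · simp only [mul_zero, pow_zero, mul_one, one_mul, potential]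
    refine Finset.sum_le_card_nsmul _ _ _ fun u _ => ?_
    refine (Nat.mul_le_mul_left _ (Nat.le_succ _)).trans ((weight_mul_le _ _).trans ?_)
    have h1 := hU u
    have h2 := I.G.degree_lt_card_verts u
    rw [Fintype.card_fin] at h2
    omega

/-- The weight of the conflicts that remain after the next bit, for the seed `(a, b)`. -/
noncomputable def seedCost (I : ListColoringInstance n C) (col : Fin n → Option ℕ) (q : ℕ)
    (x : Fin n → ℕ) (pre : Fin n → ℕ) (z : Fin n → ℕ → ℕ) (a b : ℕ) : ℕ :=
  ∑ u ∈ uncolored col, weight q (z u (chosenBit q (z u) (affineHash q a b (x u)))) *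
    (I.rivals col (fun v => 2 * pre v + chosenBit q (z v) (affineHash q a b (x v))) u).card

/-- Only pairs that were already rivals can agree on the longer prefix. The cost is therefore a sum
over rival pairs, and `sum_conflict_weight_le` applies to each pair. -/
theorem sum_seedCost_le {q : ℕ} (hq : q.Prime) {x : Fin n → ℕ} (hx : ∀ v, x v < q)
    (hinj : Function.Injective x) {pre s : Fin n → ℕ} {z : Fin n → ℕ → ℕ}
    (hs : ∀ v ∈ uncolored col, 0 < s v ∧ s v ≤ z v 0 + z v 1 ∧ z v 0 + z v 1 ≤ n) :
    ∑ a ∈ Finset.range q, ∑ b ∈ Finset.range q, I.seedCost col q x pre z a b ≤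
      (q + n) ^ 2 * I.potential col q pre s := by
  have h1 : ∀ a b u, weight q (z u (chosenBit q (z u) (affineHash q a b (x u)))) *
      (I.rivals col (fun v => 2 * pre v + chosenBit q (z v) (affineHash q a b (x v))) u).card =
      ∑ w ∈ I.rivals col pre u,
        if chosenBit q (z w) (affineHash q a b (x w)) = chosenBit q (z u) (affineHash q a b (x u))
        then weight q (z u (chosenBit q (z u) (affineHash q a b (x u)))) else 0 := by
    intro a b u
    have e : I.rivals col (fun v => 2 * pre v + chosenBit q (z v) (affineHash q a b (x v))) u =
        (I.rivals col pre u).filter fun w =>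
          chosenBit q (z w) (affineHash q a b (x w)) = chosenBit q (z u) (affineHash q a b (x u)) := by
      ext w
      have h1 := chosenBit_le_one q (z w) (affineHash q a b (x w))
      have h2 := chosenBit_le_one q (z u) (affineHash q a b (x u))
      simp only [rivals, Finset.mem_filter]
      constructor
      · rintro ⟨h3, h4, h5⟩
        exact ⟨⟨h3, h4, by omega⟩, by omega⟩
      · rintro ⟨⟨h3, h4, h5⟩, h6⟩
        exact ⟨h3, h4, by omega⟩
    rw [e, ← Finset.sum_filter, Finset.sum_const, smul_eq_mul, mul_comm]
  have h2 : ∀ a b, I.seedCost col q x pre z a b = ∑ u ∈ uncolored col, ∑ w ∈ I.rivals col pre u,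
      if chosenBit q (z w) (affineHash q a b (x w)) = chosenBit q (z u) (affineHash q a b (x u))
      then weight q (z u (chosenBit q (z u) (affineHash q a b (x u)))) else 0 := fun a b =>
    Finset.sum_congr rfl fun u _ => h1 a b u
  simp only [h2]
  rw [Finset.sum_congr rfl fun a _ => Finset.sum_comm, Finset.sum_comm, potential, Finset.mul_sum]
  refine Finset.sum_le_sum fun u hu => ?_
  rw [Finset.sum_congr rfl fun a _ => Finset.sum_comm, Finset.sum_comm, mul_comm (weight _ _),
    mul_left_comm]
  refine Finset.sum_le_card_nsmul _ _ _ fun w hw => ?_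
  obtain ⟨h3, h4, h5⟩ := hs u hu
  -- Rivals are adjacent, hence distinct, so the hash has different arguments and their values are
  -- independent.
  have hne : x u ≠ x w := fun h => by
    have hadj := (Finset.mem_filter.1 hw).1
    rw [hinj h] at hadj
    simp at hadj
  refine (sum_conflict_weight_le hq (hx u) (hx w) hne (z' := z w) (h3.trans_le h4) h5).trans ?_
  exact Nat.mul_le_mul_left _ (weight_anti h3 h4)

theorem slack_bounds {ℓ : ℕ} {pre s : Fin n → ℕ}
    (hs : ∀ v ∈ uncolored col, 0 < s v ∧
      s v + I.nbrColorCount col (ℓ + 1) (pre v) v ≤ I.colorCount (ℓ + 1) (pre v) v) :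
    ∀ v ∈ uncolored col, 0 < s v ∧
      s v ≤ I.slack col ℓ (2 * pre v + 0) v + I.slack col ℓ (2 * pre v + 1) v ∧
      I.slack col ℓ (2 * pre v + 0) v + I.slack col ℓ (2 * pre v + 1) v ≤ n := by
  intro v hv
  obtain ⟨h1, h2⟩ := hs v hv
  have h3 := colorCount_le (I := I) (ℓ + 1) (pre v) v
  rw [colorCount_succ] at h2 h3
  rw [nbrColorCount_succ] at h2
  refine ⟨h1, ?_, ?_⟩ <;> simp only [slack, add_zero] <;> omega

/-- One more bit of all candidate colors, chosen with the best seed. -/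
theorem PrefixInvariant.step {q ℓ m : ℕ} (hq : q.Prime) {x : Fin n → ℕ} (hx : ∀ v, x v < q)
    (hinj : Function.Injective x) {pre : Fin n → ℕ} (h : I.PrefixInvariant col q (ℓ + 1) m pre)
    {z : Fin n → ℕ → ℕ} (hz : ∀ v, ∀ k ≤ 1, z v k = I.slack col ℓ (2 * pre v + k) v) {a b : ℕ}
    (ha : q * ∑ b ∈ Finset.range q, I.seedCost col q x pre z a b ≤
      ∑ a ∈ Finset.range q, ∑ b ∈ Finset.range q, I.seedCost col q x pre z a b)
    (hb : q * I.seedCost col q x pre z a b ≤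
      ∑ b ∈ Finset.range q, I.seedCost col q x pre z a b) :
    I.PrefixInvariant col q ℓ (m + 1)
      fun v => 2 * pre v + chosenBit q (z v) (affineHash q a b (x v)) := by
  obtain ⟨s, hs, hpot⟩ := h
  have hs' := slack_bounds hs
  simp only [← hz _ 0 (by omega), ← hz _ 1 le_rfl] at hs'
  refine ⟨fun v => z v (chosenBit q (z v) (affineHash q a b (x v))), fun v hv => ?_, ?_⟩
  · obtain ⟨h1, h2, -⟩ := hs' v hv
    have hpos := slack_chosenBit_pos (q := q) (z := z v) (h := affineHash q a b (x v))
      (Nat.mod_lt _ hq.pos) (h1.trans_le h2)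
    have hle : chosenBit q (z v) (affineHash q a b (x v)) ≤ 1 := by
      rcases chosenBit_le_one q (z v) (affineHash q a b (x v)) with h | h <;> omega
    refine ⟨hpos, ?_⟩
    simp only [hz v _ hle, slack] at hpos ⊢
    omega
  · have h1 : q * (q * I.seedCost col q x pre z a b) ≤ (q + n) ^ 2 * I.potential col q pre s := by
      exact (Nat.mul_le_mul_left _ hb).trans (ha.trans (sum_seedCost_le hq hx hinj hs'))
    calc I.seedCost col q x pre z a b * q ^ (2 * (m + 1))
        = q * (q * I.seedCost col q x pre z a b) * q ^ (2 * m) := by ring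
      _ ≤ (q + n) ^ 2 * I.potential col q pre s * q ^ (2 * m) := Nat.mul_le_mul_right _ h1
      _ = (q + n) ^ 2 * (I.potential col q pre s * q ^ (2 * m)) := by ring
      _ ≤ (q + n) ^ 2 * ((q + n) ^ (2 * m) * ((uncolored col).card * (q + n))) :=
        Nat.mul_le_mul_left _ hpot
      _ = _ := by ring

/-- Nodes keep their candidate color unless a rival has a smaller key. -/
noncomputable def keepColors (I : ListColoringInstance n C) (col : Fin n → Option ℕ)
    (pre key : Fin n → ℕ) (v : Fin n) : Option ℕ :=
  if col v = none ∧ ((I.rivals col pre v).filter fun w => key w < key v).card = 0 then some (pre v)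
  else col v

/-- With all bits fixed every slack is 1 and every weight at least `q`, so the potential bounds the
number of ordered rival pairs by 3/2 of the number of uncolored nodes. Each rival pair prevents only
its larger key from keeping its candidate, so at most half as many nodes as ordered pairs, that is
3/4 of the nodes, stay uncolored. -/
theorem PrefixInvariant.card_uncolored_keepColors_le {q B : ℕ} {pre key : Fin n → ℕ}
    (hkey : Function.Injective key) (hq0 : 0 < q) (hq : 3 * (2 * B + 1) * n ≤ q)
    (h : I.PrefixInvariant col q 0 B pre) :
    4 * (uncolored (I.keepColors col pre key)).card ≤ 3 * (uncolored col).card := by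
  obtain ⟨s, hs, hpot⟩ := h
  have hs1 : ∀ v ∈ uncolored col, s v = 1 := by
    intro v hv
    obtain ⟨h1, h2⟩ := hs v hv
    have h3 : I.colorCount 0 (pre v) v ≤ 1 :=
      Finset.card_le_one.2 fun a ha b hb => by simp at ha hb; omega
    omega
  have hpot' : q * ∑ u ∈ uncolored col, (I.rivals col pre u).card ≤ I.potential col q pre s := by
    rw [potential, Finset.mul_sum]
    refine Finset.sum_le_sum fun u hu => Nat.mul_le_mul_right _ ?_
    rw [hs1 u hu, weight, Nat.div_one]
    exact Nat.le_succ q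
  let below (u : Fin n) := (I.rivals col pre u).filter fun w => key w < key u
  let above (u : Fin n) := (I.rivals col pre u).filter fun w => key u < key w
  have hsplit : ∀ u, (I.rivals col pre u).card = (below u).card + (above u).card := by
    intro u
    rw [← Finset.card_union_of_disjoint, ← Finset.filter_or, Finset.filter_true_of_mem]
    · intro w hw
      refine lt_or_gt_of_ne fun hwu => ?_
      have hadj := (Finset.mem_filter.1 hw).1
      rw [hkey hwu] at hadj
      simp at hadj
    · exact Finset.disjoint_filter.2 fun w _ h1 h2 => by omega
  -- Each conflicting edge is counted once from its endpoint of smaller key and once from the other.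
  have hswap : ∑ u ∈ uncolored col, (above u).card = ∑ u ∈ uncolored col, (below u).card := by
    have e1 : ∀ u ∈ uncolored col, (above u).card =
        ∑ w ∈ uncolored col, if I.G.Adj u w ∧ pre u = pre w ∧ key u < key w then 1 else 0 := by
      intro u _
      rw [Finset.card_eq_sum_ones, ← Finset.sum_filter]
      congr 1
      ext w
      simp [above, rivals, mem_uncolored]
      tauto
    have e2 : ∀ u ∈ uncolored col, (below u).card =
        ∑ w ∈ uncolored col, if I.G.Adj w u ∧ pre w = pre u ∧ key w < key u then 1 else 0 := by
      intro u _
      rw [Finset.card_eq_sum_ones, ← Finset.sum_filter]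
      congr 1
      ext w
      simp [below, rivals, mem_uncolored, I.G.adj_comm w u]
      tauto
    rw [Finset.sum_congr rfl e1, Finset.sum_congr rfl e2, Finset.sum_comm]
  have hkilled : (uncolored (I.keepColors col pre key)).card ≤ ∑ u ∈ uncolored col, (below u).card := by
    have hsub : uncolored (I.keepColors col pre key) ⊆ uncolored col := by
      intro v hv
      rw [mem_uncolored] at hv ⊢
      by_contra h0
      simp [keepColors, h0] at hv
    refine le_trans ?_ (Finset.sum_le_sum_of_subset hsub)
    rw [Finset.card_eq_sum_ones]
    refine Finset.sum_le_sum fun v hv => ?_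
    have hv' := mem_uncolored.1 (hsub hv)
    rw [mem_uncolored, keepColors] at hv
    by_contra h0
    rw [if_pos ⟨hv', by simp only [below] at h0; omega⟩] at hv
    cases hv
  have htot : 2 * (uncolored (I.keepColors col pre key)).card ≤
      ∑ u ∈ uncolored col, (I.rivals col pre u).card := by
    simp only [hsplit, Finset.sum_add_distrib, hswap]
    omega
  have h1 : 2 * (uncolored (I.keepColors col pre key)).card * q ^ (2 * B + 1) ≤
      (q + n) ^ (2 * B + 1) * (uncolored col).card := by
    calc _ ≤ (∑ u ∈ uncolored col, (I.rivals col pre u).card) * q ^ (2 * B + 1) :=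
          Nat.mul_le_mul_right _ htot
      _ = (q * ∑ u ∈ uncolored col, (I.rivals col pre u).card) * q ^ (2 * B) := by ring
      _ ≤ I.potential col q pre s * q ^ (2 * B) := Nat.mul_le_mul_right _ hpot'
      _ ≤ _ := hpot
      _ = _ := by ring
  have h2 := two_mul_add_pow_le hq0 hq
  refine Nat.le_of_mul_le_mul_right ?_ (pow_pos hq0 (2 * B + 1))
  calc _ = 2 * (2 * (uncolored (I.keepColors col pre key)).card * q ^ (2 * B + 1)) := by ring
    _ ≤ 2 * ((q + n) ^ (2 * B + 1) * (uncolored col).card) := Nat.mul_le_mul_left _ h1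
    _ = (2 * (q + n) ^ (2 * B + 1)) * (uncolored col).card := by ring
    _ ≤ (3 * q ^ (2 * B + 1)) * (uncolored col).card := Nat.mul_le_mul_right _ h2
    _ = _ := by ring

/-- A full-length prefix matches at most one list color, so positive slack means that the candidate
is in the list and no colored neighbor has it. If two adjacent nodes both kept the same candidate,
neither would have the smaller key. -/
theorem PrefixInvariant.isPartialColoring_keepColors {q m : ℕ} {pre key : Fin n → ℕ}
    (hkey : Function.Injective key) (hcol : I.IsPartialColoring col)
    (h : I.PrefixInvariant col q 0 m pre) : I.IsPartialColoring (I.keepColors col pre key) := by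
  classical
  obtain ⟨s, hs, -⟩ := h
  have hmem : ∀ v, col v = none → pre v ∈ I.L v := by
    intro v hv
    obtain ⟨h1, h2⟩ := hs v (mem_uncolored.2 hv)
    have h3 : 0 < I.colorCount 0 (pre v) v := by omega
    obtain ⟨k, hk⟩ := Finset.card_pos.1 h3
    simp at hk
    exact hk.2 ▸ hk.1
  have hnbr : ∀ v, col v = none → ∀ w, I.G.Adj v w → col w ≠ some (pre v) := by
    intro v hv w hw hc
    obtain ⟨h1, h2⟩ := hs v (mem_uncolored.2 hv)
    have h3 : I.colorCount 0 (pre v) v ≤ 1 :=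
      Finset.card_le_one.2 fun a ha b hb => by simp at ha hb; omega
    have h4 : 0 < I.nbrColorCount col 0 (pre v) v :=
      Finset.card_pos.2 ⟨w, by simpa [hw] using hc⟩
    omega
  have hcase : ∀ v k, I.keepColors col pre key v = some k →
      col v = some k ∨ (col v = none ∧ k = pre v ∧
        ∀ w, I.G.Adj v w → col w = none → pre w = pre v → key v ≤ key w) := by
    intro v k hk
    unfold keepColors at hk
    split_ifs at hk with hc
    · refine Or.inr ⟨hc.1, by simpa using hk.symm, fun w h1 h2 h3 => ?_⟩
      have := Finset.eq_empty_iff_forall_notMem.1 (Finset.card_eq_zero.1 hc.2) w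
      simp [rivals, h1, h2, h3] at this
      exact this
    · exact Or.inl hk
  refine ⟨fun v k hk => ?_, fun u v huv k hu hv => ?_⟩
  · rcases hcase v k hk with h | ⟨h, rfl, -⟩
    · exact hcol.1 v k h
    · exact hmem v h
  · rcases hcase u k hu with hu | ⟨hu, hk₀, hu'⟩ <;> rcases hcase v _ hv with hv | ⟨hv, hk, hv'⟩
    · exact hcol.2 u v huv k hu hv
    · exact hnbr v hv u huv.symm (hk ▸ hu)
    · exact hnbr u hu v huv (hk₀ ▸ hv)
    · have h1 := hu' v huv hv (hk.symm.trans hk₀)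
      have h2 := hv' u huv.symm hu (hk₀.symm.trans hk)
      exact huv.ne (hkey (le_antisymm h1 h2))

/-- Greedy coloring: the neighbors block at most deg of the deg + 1 list colors, and coloring one
more node preserves the hypothesis. -/
theorem IsPartialColoring.exists_extension (h : I.IsPartialColoring col) :
    ∃ φ : Fin n → ℕ, I.IsListColoring φ ∧ ∀ v k, col v = some k → φ v = k := by
  classical
  induction hm : (uncolored col).card generalizing col with
  | zero =>
    have hne : ∀ v, ∃ k, col v = some k := by
      intro v
      rw [← Option.ne_none_iff_exists']
      intro hv
      have := Finset.card_eq_zero.1 hm ▸ mem_uncolored.2 hv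
      simp at this
    choose φ hφ using hne
    refine ⟨φ, ⟨fun u v huv he => h.2 u v huv (φ u) (hφ u) (he ▸ hφ v), fun v => h.1 v _ (hφ v)⟩,
      fun v k hk => ?_⟩
    rw [hφ v] at hk
    exact Option.some.inj hk
  | succ m ih =>
    obtain ⟨v, hv⟩ := Finset.card_pos.1 (show 0 < (uncolored col).card by omega)
    have hv' := mem_uncolored.1 hv
    obtain ⟨k, hk, hk'⟩ : ∃ k ∈ I.L v, ∀ w, I.G.Adj v w → col w ≠ some k := by
      -- Uncolored neighbors contribute the dummy color 0. This may forbid a color needlessly, but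
      -- the forbidden set still has at most deg elements.
      have hlt : ((I.G.neighborFinset v).image fun w => (col w).getD 0).card < (I.L v).card := by
        rw [I.card_L, Nat.lt_succ_iff, ← I.G.card_neighborFinset_eq_degree]
        exact Finset.card_image_le
      obtain ⟨k, hk, hk'⟩ := Finset.exists_mem_notMem_of_card_lt_card hlt
      refine ⟨k, hk, fun w hw hc => hk' (Finset.mem_image.2 ⟨w, by simpa using hw, by simp [hc]⟩)⟩
    have hcol' : I.IsPartialColoring (Function.update col v (some k)) := by
      refine ⟨fun u k' hu => ?_, fun u w huw k' hu hw => ?_⟩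
      · by_cases huv : u = v
        · subst huv
          simp at hu
          exact hu ▸ hk
        · simp [huv] at hu
          exact h.1 u k' hu
      · by_cases huv : u = v <;> by_cases hwv : w = v
        · exact huw.ne (huv.trans hwv.symm)
        · subst huv
          simp [hwv] at hu hw
          exact hk' w huw (hu ▸ hw)
        · subst hwv
          simp [huv] at hu hw
          exact hk' u huw.symm (hw ▸ hu)
        · simp [huv, hwv] at hu hw
          exact h.2 u w huw k' hu hw
    obtain ⟨φ, hφ, hφ'⟩ := ih hcol' (by
      have : uncolored (Function.update col v (some k)) = (uncolored col).erase v := by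
        ext u
        by_cases huv : u = v
        · subst huv; simp [mem_uncolored]
        · simp [mem_uncolored, huv]
      rw [this, Finset.card_erase_of_mem hv, hm]
      rfl)
    refine ⟨φ, hφ, fun u k' hu => hφ' u k' ?_⟩
    have : u ≠ v := fun huv => by rw [huv, hv'] at hu; cases hu
    simpa [this] using hu

end ListColoringInstance

/-! ### Counts as sums over the input shares -/

open Classical in
/-- The number of edges from `a` to some `w` with `p w`. -/
noncomputable def nbrCount (E : Finset (Sym2 ℕ)) (a : ℕ) (p : ℕ → Prop) : ℕ :=
  (E.filter fun e => ∃ w, e = s(a, w) ∧ p w).card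

open Classical in
/-- The number of list entries of `a` with a color `c` such that `p c`. -/
noncomputable def entryCount (T : Finset (ℕ × ℕ)) (a : ℕ) (p : ℕ → Prop) : ℕ :=
  (T.filter fun t => t.1 = a ∧ p t.2).card

/-- Every input item lies on exactly one machine, so local counts add up to the global count for any
placement. -/
theorem sum_card_filter_image_fiber {α γ : Type} [DecidableEq α] [DecidableEq γ] {M : ℕ} (E : Finset α) (loc : α → Fin M) {f : α → γ}
    (hf : Function.Injective f) (p : γ → Prop) [DecidablePred p] :
    ∑ i, (((E.filter fun e => loc e = i).image f).filter p).card =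
      (E.filter fun e => p (f e)).card := by
  rw [Finset.card_eq_sum_card_fiberwise (t := Finset.univ) (f := loc) fun _ _ => by simp]
  refine Finset.sum_congr rfl fun i _ => ?_
  rw [Finset.filter_image, Finset.card_image_of_injective _ hf, Finset.filter_filter,
    Finset.filter_filter]
  simp only [and_comm]

namespace InputDistribution

variable {n C M S : ℕ} {I : ListColoringInstance n C} (D : InputDistribution I M S)

theorem sum_nbrCount (v : Fin n) (p : ℕ → Prop) [DecidablePred p] :
    ∑ i, nbrCount (D.share i).edges (I.ident v) p =
      ((I.G.neighborFinset v).filter fun w => p (I.ident w)).card := by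
  classical
  unfold nbrCount
  simp only [share, ListColoringInstance.shareOf]
  have := sum_card_filter_image_fiber I.G.edgeFinset D.edgeLoc
    (Sym2.map.injective I.ident.injective) fun e => ∃ w, e = s(I.ident v, w) ∧ p w
  rw [this]
  symm
  refine Finset.card_bij (fun w _ => s(v, w)) ?_ ?_ ?_
  · intro w hw
    simp only [Finset.mem_filter, SimpleGraph.mem_neighborFinset] at hw
    simp only [Finset.mem_filter, SimpleGraph.mem_edgeFinset, SimpleGraph.mem_edgeSet]
    exact ⟨hw.1, I.ident w, rfl, hw.2⟩
  · intro w _ w' _ h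
    exact Sym2.congr_right.1 h
  · intro e he
    simp only [Finset.mem_filter, SimpleGraph.mem_edgeFinset] at he
    obtain ⟨he, w', hw', hp⟩ := he
    have hv : v ∈ e := by
      have : I.ident v ∈ Sym2.map I.ident e := by rw [hw']; simp
      obtain ⟨u, hu, huv⟩ := Sym2.mem_map.1 this
      rwa [← I.ident.injective huv]
    obtain ⟨w, rfl⟩ := Sym2.mem_iff_exists.1 hv
    refine ⟨w, ?_, rfl⟩
    rw [Sym2.map_mk, Sym2.congr_right] at hw'
    simp only [Finset.mem_filter, SimpleGraph.mem_neighborFinset]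
    exact ⟨he, hw' ▸ hp⟩

theorem sum_entryCount (v : Fin n) (p : ℕ → Prop) [DecidablePred p] :
    ∑ i, entryCount (D.share i).entries (I.ident v) p = ((I.L v).filter p).card := by
  classical
  unfold entryCount
  simp only [share, ListColoringInstance.shareOf]
  have hinj : Function.Injective fun t : (_ : Fin n) × ℕ => (I.ident t.1, t.2) := by
    rintro ⟨u, c⟩ ⟨u', c'⟩ h
    simp only [Prod.mk.injEq, EmbeddingLike.apply_eq_iff_eq] at h
    obtain ⟨rfl, rfl⟩ := h
    rfl
  have := sum_card_filter_image_fiber (Finset.univ.sigma I.L) (fun t => D.listLoc t.1 t.2) hinj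
    fun t => t.1 = I.ident v ∧ p t.2
  refine Eq.trans (by congr!) (this.trans ?_)
  symm
  refine Finset.card_bij (fun c _ => ⟨v, c⟩) ?_ ?_ ?_
  · intro c hc
    simpa using hc
  · intro c _ c' _ h
    simpa using h
  · rintro ⟨u, c⟩ h
    simp only [Finset.mem_filter, Finset.mem_sigma, Finset.mem_univ, true_and,
      EmbeddingLike.apply_eq_iff_eq] at h
    obtain ⟨h1, rfl, h2⟩ := h
    exact ⟨c, by simp [h1, h2], rfl⟩

theorem exists_mem_edges_iff (e : Sym2 ℕ) :
    (∃ i, e ∈ (D.share i).edges) ↔ ∃ u v, I.G.Adj u v ∧ e = s(I.ident u, I.ident v) := by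
  simp only [share, ListColoringInstance.shareOf, Finset.mem_image, Finset.mem_filter,
    SimpleGraph.mem_edgeFinset]
  constructor
  · rintro ⟨i, e', ⟨h, -⟩, rfl⟩
    induction e' with
    | _ u v => exact ⟨u, v, h, rfl⟩
  · rintro ⟨u, v, h, rfl⟩
    exact ⟨_, s(u, v), ⟨h, rfl⟩, rfl⟩

theorem exists_mem_entries_iff (t : ℕ × ℕ) :
    (∃ i, t ∈ (D.share i).entries) ↔ ∃ v, ∃ c ∈ I.L v, t = (I.ident v, c) := by
  simp only [share, ListColoringInstance.shareOf, Finset.mem_image, Finset.mem_filter,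
    Finset.mem_sigma, Finset.mem_univ, true_and]
  constructor
  · rintro ⟨i, ⟨v, c⟩, ⟨h, -⟩, rfl⟩
    exact ⟨v, c, h, rfl⟩
  · rintro ⟨v, c, h, rfl⟩
    exact ⟨_, ⟨v, c⟩, ⟨h, rfl⟩, rfl⟩

end InputDistribution

/-! ### The coloring protocol -/

/-- A piece of input: an edge or a list entry. -/
abbrev InputItem : Type := Sym2 ℕ ⊕ (ℕ × ℕ)

/-- The number of smaller identifiers. -/
def rankIn (ids : Finset ℕ) (a : ℕ) : ℕ := (ids.filter (· < a)).card

/-- The vector that holds the numbers `f a 0, …, f a 3` for every `a ∈ ids`, in order. -/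
def spread (ids : Finset ℕ) (f : ℕ → ℕ → ℕ) (r : ℕ) : ℕ :=
  ∑ a ∈ ids, if r / 4 = rankIn ids a then f a (r % 4) else 0

theorem rankIn_lt {ids : Finset ℕ} {a b : ℕ} (ha : a ∈ ids) (hab : a < b) :
    rankIn ids a < rankIn ids b := by
  refine Finset.card_lt_card ⟨fun c hc => ?_, fun h => ?_⟩
  · simp only [Finset.mem_filter] at hc ⊢
    exact ⟨hc.1, hc.2.trans hab⟩
  · have := h (Finset.mem_filter.2 ⟨ha, hab⟩)
    simp at this

theorem rankIn_injOn {ids : Finset ℕ} {a b : ℕ} (ha : a ∈ ids) (hb : b ∈ ids)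
    (h : rankIn ids a = rankIn ids b) : a = b := by
  rcases lt_trichotomy a b with hab | hab | hab
  · exact absurd h (rankIn_lt ha hab).ne
  · exact hab
  · exact absurd h (rankIn_lt hb hab).ne'

theorem rankIn_lt_card {ids : Finset ℕ} {a : ℕ} (ha : a ∈ ids) : rankIn ids a < ids.card := by
  refine Finset.card_lt_card ⟨Finset.filter_subset _ _, fun h => ?_⟩
  have := h ha
  simp at this

theorem spread_apply {ids : Finset ℕ} {f : ℕ → ℕ → ℕ} {a k : ℕ} (ha : a ∈ ids) (hk : k < 4) :
    spread ids f (4 * rankIn ids a + k) = f a k := by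
  have h1 : (4 * rankIn ids a + k) / 4 = rankIn ids a := by omega
  have h2 : (4 * rankIn ids a + k) % 4 = k := by omega
  rw [spread, h1, h2, Finset.sum_eq_single a]
  · simp
  · intro b hb hba
    rw [if_neg]
    exact fun h => hba (rankIn_injOn ha hb h).symm
  · exact fun h => absurd ha h

theorem sum_spread {M : ℕ} (ids : Finset ℕ) (f : Fin M → ℕ → ℕ → ℕ) (r : ℕ) :
    ∑ i, spread ids (f i) r = spread ids (fun a k => ∑ i, f i a k) r := by
  unfold spread
  rw [Finset.sum_comm]
  refine Finset.sum_congr rfl fun a _ => ?_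
  split_ifs <;> simp

theorem spread_le {ids : Finset ℕ} {f : ℕ → ℕ → ℕ} {m : ℕ} (h : ∀ a ∈ ids, ∀ k, f a k ≤ m) (r : ℕ) :
    spread ids f r ≤ ids.card * m := by
  refine Finset.sum_le_card_nsmul _ _ _ fun a ha => ?_
  split_ifs
  · exact h a ha _
  · exact Nat.zero_le _

/-- The public state of the coloring protocol. Nodes are given by their identifiers. -/
inductive ColoringState
  | start
  | degrees (ids : Finset ℕ)
  | counts (ids : Finset ℕ) (deg : ℕ → ℕ) (col : ℕ → Option ℕ) (pre : ℕ → ℕ) (ℓ : ℕ)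
  | firstSeed (ids : Finset ℕ) (deg : ℕ → ℕ) (col : ℕ → Option ℕ) (pre : ℕ → ℕ) (ℓ : ℕ)
      (z : ℕ → ℕ → ℕ)
  | secondSeed (ids : Finset ℕ) (deg : ℕ → ℕ) (col : ℕ → Option ℕ) (pre : ℕ → ℕ) (ℓ : ℕ)
      (z : ℕ → ℕ → ℕ) (a : ℕ)
  | conflicts (ids : Finset ℕ) (deg : ℕ → ℕ) (col : ℕ → Option ℕ) (pre : ℕ → ℕ)
  | collect (ids : Finset ℕ) (col : ℕ → Option ℕ)
  | done (o : List (ℕ × ℕ))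

namespace ColoringState

/-- The prefixes after the bits that are chosen with the seed `(a, b)`. -/
def extendPrefix (q : ℕ) (ids : Finset ℕ) (pre : ℕ → ℕ) (z : ℕ → ℕ → ℕ) (a b w : ℕ) : ℕ :=
  2 * pre w + chosenBit q (z w) (affineHash q a b (rankIn ids w))

/-- The contribution of a share to the cost of the seed `(a, b)`. -/
noncomputable def shareCost (q : ℕ) (ids : Finset ℕ) (col : ℕ → Option ℕ) (pre : ℕ → ℕ)
    (z : ℕ → ℕ → ℕ) (x : InputShare) (a b : ℕ) : ℕ :=
  ∑ u ∈ ids.filter (fun u => col u = none),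
    weight q (z u (chosenBit q (z u) (affineHash q a b (rankIn ids u)))) *
      nbrCount x.edges u fun w =>
        col w = none ∧ extendPrefix q ids pre z a b w = extendPrefix q ids pre z a b u

/-- The state with `ℓ` bits left to be chosen. -/
def nextBit (ids : Finset ℕ) (deg : ℕ → ℕ) (col : ℕ → Option ℕ) (pre : ℕ → ℕ) : ℕ → ColoringState
  | 0 => conflicts ids deg col pre
  | ℓ + 1 => counts ids deg col pre ℓ

/-- If little input is left, collect it; otherwise color some more nodes. -/
def newPhase (n B : ℕ) (ids : Finset ℕ) (deg : ℕ → ℕ) (col : ℕ → Option ℕ) : ColoringState :=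
  if ∑ a ∈ ids.filter (fun a => col a = none), (deg a + 1) ≤ 2 * n then collect ids col
  else nextBit ids deg col (fun _ => 0) B

/-- `φ` extends `col` to a coloring that is compatible with the collected input. -/
def Completes (ids : Finset ℕ) (col : ℕ → Option ℕ) (Y : Finset InputItem) (φ : ℕ → ℕ) : Prop :=
  (∀ a ∈ ids, ∀ k, col a = some k → φ a = k) ∧
  (∀ a ∈ ids, col a = none → Sum.inr (a, φ a) ∈ Y) ∧
  ∀ a a', Sum.inl s(a, a') ∈ Y → φ a ≠ φ a'

open Classical in
noncomputable def finish (ids : Finset ℕ) (col : ℕ → Option ℕ) (Y : Finset InputItem) :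
    List (ℕ × ℕ) :=
  if h : ∃ φ, Completes ids col Y φ then ids.toList.map fun a => (a, h.choose a) else []

end ColoringState

open ColoringState in
open Classical in
/-- The coloring protocol for `n` nodes and colors of `B` bits, with seeds modulo `q`. -/
noncomputable def coloringProtocol (n B q : ℕ) : BoardProtocol InputItem ColoringState where
  init := start
  isUnion
    | start => true
    | collect _ _ => true
    | _ => false
  vec
    | degrees ids, x => spread ids fun a _ => nbrCount x.edges a fun _ => True
    | counts ids _ col pre ℓ, x => spread ids fun a k =>
        if k < 2 then entryCount x.entries a fun c => c / 2 ^ ℓ = 2 * pre a + k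
        else nbrCount x.edges a fun w => ∃ c, col w = some c ∧ c / 2 ^ ℓ = 2 * pre a + (k - 2)
    | firstSeed ids _ col pre _ z, x => fun a =>
        ∑ b ∈ Finset.range q, shareCost q ids col pre z x a b
    | secondSeed ids _ col pre _ z a, x => fun b => shareCost q ids col pre z x a b
    | conflicts ids _ col pre, x => spread ids fun a _ => nbrCount x.edges a fun w =>
        (col w = none ∧ pre w = pre a) ∧ w < a
    | _, _ => fun _ => 0
  set
    | start, x => x.entries.image fun t => .inr (t.1, 0)
    | collect _ col, x => (x.edges.filter fun e => ∃ a ∈ e, col a = none).image .inl ∪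
        (x.entries.filter fun t => col t.1 = none).image .inr
    | _, _ => ∅
  nextSum
    | degrees ids, f => newPhase n B ids (fun a => f (4 * rankIn ids a + 0)) fun _ => none
    | counts ids deg col pre ℓ, f => firstSeed ids deg col pre ℓ fun a k =>
        f (4 * rankIn ids a + k) - f (4 * rankIn ids a + (2 + k))
    | firstSeed ids deg col pre ℓ z, f => secondSeed ids deg col pre ℓ z (argMin q f)
    | secondSeed ids deg col pre ℓ z a, f =>
        nextBit ids deg col (extendPrefix q ids pre z a (argMin q f)) ℓ
    | conflicts ids deg col pre, f => newPhase n B ids deg fun a =>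
        if col a = none ∧ f (4 * rankIn ids a + 0) = 0 then some (pre a) else col a
    | s, _ => s
  nextUnion
    | start, Y => degrees (Y.toRight.image Prod.fst)
    | collect ids col, Y => done (finish ids col Y)
    | s, _ => s
  out
    | done o => some o
    | _ => none

/-! ### Sequences of valid steps with their cost in rounds -/

namespace BoardProtocol

variable {α β : Type} [DecidableEq α] {M : ℕ}

/-- `k` valid steps lead from the public state `b` to `b'`, and take `c` rounds. -/
def Path (P : BoardProtocol α β) (R W K : ℕ) (U : Set α) (x : Fin M → InputShare) (b : β) (k c : ℕ)
    (b' : β) : Prop :=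
  (∀ j < k, P.ValidStep R W U x ((P.next R x)^[j] b)) ∧ (P.next R x)^[k] b = b' ∧
    ∑ j ∈ Finset.range k, P.cost K ((P.next R x)^[j] b) = c

namespace Path

variable {P : BoardProtocol α β} {R W K : ℕ} {U : Set α} {x : Fin M → InputShare} {b b' b'' : β}
  {k k' c c' : ℕ}

theorem refl : P.Path R W K U x b 0 0 b := ⟨by simp, rfl, rfl⟩

theorem single (h : P.ValidStep R W U x b) (hb : P.next R x b = b') :
    P.Path R W K U x b 1 (P.cost K b) b' :=
  ⟨fun j hj => by rwa [show j = 0 by omega], hb, by simp⟩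

theorem trans (h : P.Path R W K U x b k c b') (h' : P.Path R W K U x b' k' c' b'') :
    P.Path R W K U x b (k + k') (c + c') b'' := by
  obtain ⟨h1, rfl, rfl⟩ := h
  obtain ⟨h2, rfl, rfl⟩ := h'
  have e : ∀ j, (P.next R x)^[k + j] b = (P.next R x)^[j] ((P.next R x)^[k] b) := fun j => by
    rw [add_comm, Function.iterate_add_apply]
  refine ⟨fun j hj => ?_, e k', ?_⟩
  · by_cases hjk : j < k
    · exact h1 j hjk
    · have := h2 (j - k) (by omega)
      rwa [← e, Nat.add_sub_cancel' (not_lt.1 hjk)] at this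
  · rw [Finset.sum_range_add]
    simp only [e]

end Path

end BoardProtocol

/-! ### Correctness of the protocol, step by step -/

/-- The edges and list entries with identifiers and colors less than `N`. -/
def smallItems (N : ℕ) : Set InputItem :=
  {y | (∀ e, y = .inl e → ∀ a ∈ e, a < N) ∧ ∀ t, y = .inr t → t.1 < N ∧ t.2 < N}

namespace ListColoringInstance

/-- The set of identifiers. -/
def ids {n C : ℕ} (I : ListColoringInstance n C) : Finset ℕ := Finset.univ.map I.ident

variable {n C : ℕ} {I : ListColoringInstance n C}

theorem ident_mem_ids (v : Fin n) : I.ident v ∈ I.ids := by simp [ids]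

theorem card_ids : I.ids.card = n := by simp [ids]

theorem rank_injective : Function.Injective fun v => rankIn I.ids (I.ident v) := fun u v h =>
  I.ident.injective (rankIn_injOn (ident_mem_ids u) (ident_mem_ids v) h)

theorem rank_lt (v : Fin n) : rankIn I.ids (I.ident v) < n := by
  simpa [card_ids] using rankIn_lt_card (ident_mem_ids (I := I) v)

theorem sum_uncolored_ids (col : ℕ → Option ℕ) (f : ℕ → ℕ) :
    ∑ a ∈ I.ids.filter (fun a => col a = none), f a =
      ∑ v ∈ uncolored (fun v => col (I.ident v)), f (I.ident v) := by
  rw [ids, Finset.filter_map, Finset.sum_map]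
  rfl

end ListColoringInstance

/-- The setting in which the coloring protocol works: bounds on identifiers and colors, and a prime
modulus and a vector length in the right range. -/
structure ProtocolSetting {n C : ℕ} (I : ListColoringInstance n C) (R W N B q : ℕ) : Prop where
  ident_lt : ∀ v, I.ident v < N
  colors_le : C ≤ N
  N_pos : 0 < N
  colors_le_pow : C ≤ 2 ^ B
  prime : q.Prime
  n_pos : 0 < n
  le_modulus : 3 * (2 * B + 1) * n ≤ q
  modulus_le : q ≤ R
  four_mul_le : 4 * n ≤ R
  lt_word : q * ((q + 1) * (n * n)) < W

namespace ProtocolSetting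

open ColoringState ListColoringInstance

variable {n C M S R W N B q K : ℕ} {I : ListColoringInstance n C} (D : InputDistribution I M S)
  (hS : ProtocolSetting I R W N B q)
include hS

theorem n_le : n ≤ q := by
  refine le_trans ?_ hS.le_modulus
  exact Nat.le_mul_of_pos_left n (by omega)

theorem sq_lt : n * n < W := by
  refine lt_of_le_of_lt ?_ hS.lt_word
  rw [← mul_assoc]
  exact Nat.le_mul_of_pos_left _ (Nat.mul_pos hS.prime.pos (Nat.succ_pos _))

theorem sumResult_spread {b : ColoringState} {f : Fin M → ℕ → ℕ → ℕ}
    (hb : ∀ i, (coloringProtocol n B q).vec b (D.share i) = spread I.ids (f i)) (v : Fin n) {k : ℕ}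
    (hk : k < 4) :
    (coloringProtocol n B q).sumResult R D.share b (4 * rankIn I.ids (I.ident v) + k) =
      ∑ i, f i (I.ident v) k := by
  have h1 := rank_lt (I := I) v
  have h2 := hS.four_mul_le
  simp only [BoardProtocol.sumResult, BoardProtocol.coord]
  refine Finset.sum_congr rfl fun i _ => ?_
  rw [if_pos (by omega), hb, spread_apply (ident_mem_ids v) hk]

theorem validStep_spread {b : ColoringState} {f : Fin M → ℕ → ℕ → ℕ} {U : Set InputItem}
    (hout : (coloringProtocol n B q).out b = none) (hu : (coloringProtocol n B q).isUnion b = false)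
    (hb : ∀ i, (coloringProtocol n B q).vec b (D.share i) = spread I.ids (f i))
    (hf : ∀ v k, ∑ i, f i (I.ident v) k ≤ n) :
    (coloringProtocol n B q).ValidStep R W U D.share b := by
  refine ⟨hout, fun _ r _ => ?_, by simp [hu], by simp [hu]⟩
  simp only [hb, sum_spread]
  refine lt_of_le_of_lt (spread_le (m := n) (fun a ha k => ?_) r) ?_
  · obtain ⟨v, -, rfl⟩ := Finset.mem_map.1 ha
    exact hf v k
  · rw [card_ids]
    exact hS.sq_lt

omit hS in
theorem sum_nbrCount_le (v : Fin n) (p : ℕ → Prop) :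
    ∑ i, nbrCount (D.share i).edges (I.ident v) p ≤ n := by
  classical
  rw [D.sum_nbrCount]
  exact (Finset.card_le_univ _).trans (by simp)

omit hS in
theorem sum_entryCount_le (v : Fin n) (p : ℕ → Prop) :
    ∑ i, entryCount (D.share i).entries (I.ident v) p ≤ n := by
  classical
  rw [D.sum_entryCount]
  refine (Finset.card_filter_le _ _).trans ?_
  rw [I.card_L]
  have := I.G.degree_lt_card_verts v
  simpa using this

/-- Lists are nonempty, so every identifier occurs in some list entry, even for isolated nodes. The
color of the published items is replaced by 0, which leaves only `n` different items. -/
theorem path_start : (coloringProtocol n B q).Path R W K (smallItems N) D.share start 1 K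
    (degrees I.ids) := by
  classical
  have hmem : ∀ t, (∃ i, t ∈ (coloringProtocol n B q).set start (D.share i)) ↔
      ∃ v, t = Sum.inr (I.ident v, 0) := by
    intro t
    have : ∀ i, (coloringProtocol n B q).set start (D.share i) =
        (D.share i).entries.image fun t => Sum.inr (t.1, 0) := fun i => rfl
    simp only [this, Finset.mem_image]
    constructor
    · rintro ⟨i, t, ht, rfl⟩
      obtain ⟨v, c, -, rfl⟩ := (D.exists_mem_entries_iff t).1 ⟨i, ht⟩
      exact ⟨v, rfl⟩
    · rintro ⟨v, rfl⟩
      obtain ⟨c, hc⟩ := Finset.card_pos.1 (show 0 < (I.L v).card by rw [I.card_L]; omega)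
      obtain ⟨i, hi⟩ := (D.exists_mem_entries_iff (I.ident v, c)).2 ⟨v, c, hc, rfl⟩
      exact ⟨i, _, hi, rfl⟩
  have hres : (coloringProtocol n B q).unionResult D.share start =
      Finset.univ.image fun v => Sum.inr (I.ident v, 0) := by
    ext t
    simp only [BoardProtocol.unionResult, Finset.mem_biUnion, Finset.mem_univ, true_and, hmem,
      Finset.mem_image, eq_comm]
  refine BoardProtocol.Path.single ⟨rfl, by simp [coloringProtocol], fun _ i a ha => ?_, fun _ => ?_⟩ ?_
  · obtain ⟨v, rfl⟩ := (hmem a).1 ⟨i, ha⟩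
    exact ⟨by simp, fun t ht => by cases ht; exact ⟨hS.ident_lt v, hS.N_pos⟩⟩
  · rw [hres]
    refine Finset.card_image_le.trans ?_
    have := hS.four_mul_le
    simp; omega
  · have : (coloringProtocol n B q).next R D.share start =
        degrees (((coloringProtocol n B q).unionResult D.share start).toRight.image Prod.fst) := rfl
    rw [this, hres]
    congr 1
    ext a
    simp [ids]

theorem path_degrees : ∃ deg : ℕ → ℕ, (∀ v, deg (I.ident v) = I.G.degree v) ∧
    (coloringProtocol n B q).Path R W K (smallItems N) D.share (degrees I.ids) 1 2
      (newPhase n B I.ids deg fun _ => none) := by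
  classical
  have hb : ∀ i, (coloringProtocol n B q).vec (degrees I.ids) (D.share i) =
    spread I.ids fun a _ => nbrCount (D.share i).edges a fun _ => True := fun _ => rfl
  refine ⟨_, fun v => ?_, BoardProtocol.Path.single
    (hS.validStep_spread D rfl rfl hb fun v k => sum_nbrCount_le D v _) rfl⟩
  rw [hS.sumResult_spread D hb v (by omega), D.sum_nbrCount]
  simp

/-- Of the four slots of a node, slots 0 and 1 count list colors for the two extensions of its
prefix, and slots 2 and 3 count neighbors colored with them. -/
theorem path_counts (deg : ℕ → ℕ) (col : ℕ → Option ℕ) (pre : ℕ → ℕ) (ℓ : ℕ) :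
    ∃ z : ℕ → ℕ → ℕ,
      (∀ v, ∀ k ≤ 1, z (I.ident v) k =
        I.slack (fun v => col (I.ident v)) ℓ (2 * pre (I.ident v) + k) v) ∧
      (coloringProtocol n B q).Path R W K (smallItems N) D.share (counts I.ids deg col pre ℓ) 1 2
        (firstSeed I.ids deg col pre ℓ z) := by
  classical
  have hb : ∀ i, (coloringProtocol n B q).vec (counts I.ids deg col pre ℓ) (D.share i) =
    spread I.ids fun a k =>
        if k < 2 then entryCount (D.share i).entries a fun c => c / 2 ^ ℓ = 2 * pre a + k
        else nbrCount (D.share i).edges a fun w =>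
          ∃ c, col w = some c ∧ c / 2 ^ ℓ = 2 * pre a + (k - 2) := fun _ => rfl
  refine ⟨_, fun v k hk => ?_, BoardProtocol.Path.single
    (hS.validStep_spread D rfl rfl hb fun v k => ?_) rfl⟩
  · rw [hS.sumResult_spread D hb v (by omega), hS.sumResult_spread D hb v (by omega)]
    simp only [show k < 2 by omega, if_true, show ¬ 2 + k < 2 by omega, if_false,
      Nat.add_sub_cancel_left]
    rw [D.sum_nbrCount, D.sum_entryCount, slack, colorCount, nbrColorCount]
  · split_ifs
    · exact sum_entryCount_le D v _
    · exact sum_nbrCount_le D v _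

omit hS in
-- The cost of a seed is additive over edges, and weights, prefixes and ranks are public, so each
-- machine can evaluate its own contribution.
theorem sum_shareCost (col : ℕ → Option ℕ) (pre : ℕ → ℕ) (z : ℕ → ℕ → ℕ) (a b : ℕ) :
    ∑ i, shareCost q I.ids col pre z (D.share i) a b =
      I.seedCost (fun v => col (I.ident v)) q (fun v => rankIn I.ids (I.ident v))
        (fun v => pre (I.ident v)) (fun v => z (I.ident v)) a b := by
  classical
  unfold shareCost seedCost
  rw [Finset.sum_comm, sum_uncolored_ids col fun u =>
    ∑ i, weight q (z u (chosenBit q (z u) (affineHash q a b (rankIn I.ids u)))) *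
      nbrCount (D.share i).edges u fun w => col w = none ∧
        extendPrefix q I.ids pre z a b w = extendPrefix q I.ids pre z a b u]
  refine Finset.sum_congr rfl fun v _ => ?_
  rw [← Finset.mul_sum, D.sum_nbrCount]
  rfl

omit hS in
theorem seedCost_le (col : Fin n → Option ℕ) (x pre : Fin n → ℕ) (z : Fin n → ℕ → ℕ) (a b : ℕ) :
    I.seedCost col q x pre z a b ≤ (q + 1) * (n * n) := by
  have h : I.seedCost col q x pre z a b ≤ (uncolored col).card * ((q + 1) * n) := by
    refine Finset.sum_le_card_nsmul _ _ _ fun u _ => Nat.mul_le_mul (weight_le _ _) ?_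
    exact (Finset.card_le_univ _).trans (by simp)
  have h2 : (uncolored col).card ≤ n := (Finset.card_le_univ _).trans (by simp)
  calc _ ≤ _ := h
    _ ≤ n * ((q + 1) * n) := Nat.mul_le_mul_right _ h2
    _ = _ := by ring

theorem path_firstSeed (deg : ℕ → ℕ) (col : ℕ → Option ℕ) (pre : ℕ → ℕ) (ℓ : ℕ) (z : ℕ → ℕ → ℕ) :
    ∃ a, (let f := fun a b => I.seedCost (fun v => col (I.ident v)) q
            (fun v => rankIn I.ids (I.ident v)) (fun v => pre (I.ident v))
            (fun v => z (I.ident v)) a b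
          q * ∑ b ∈ Finset.range q, f a b ≤ ∑ a ∈ Finset.range q, ∑ b ∈ Finset.range q, f a b) ∧
      (coloringProtocol n B q).Path R W K (smallItems N) D.share (firstSeed I.ids deg col pre ℓ z) 1 2
        (secondSeed I.ids deg col pre ℓ z a) := by
  have hb : ∀ i, (coloringProtocol n B q).vec (firstSeed I.ids deg col pre ℓ z) (D.share i) =
    fun a => ∑ b ∈ Finset.range q, shareCost q I.ids col pre z (D.share i) a b := fun _ => rfl
  have hsum : ∀ a, ∑ i, (coloringProtocol n B q).vec (firstSeed I.ids deg col pre ℓ z) (D.share i) a =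
      ∑ b ∈ Finset.range q, I.seedCost (fun v => col (I.ident v)) q
            (fun v => rankIn I.ids (I.ident v)) (fun v => pre (I.ident v))
            (fun v => z (I.ident v)) a b := by
    intro a
    simp only [hb]
    rw [Finset.sum_comm]
    exact Finset.sum_congr rfl fun b _ => sum_shareCost D col pre z a b
  have hres : ∀ a < q, (coloringProtocol n B q).sumResult R D.share
      (firstSeed I.ids deg col pre ℓ z) a = ∑ b ∈ Finset.range q,
        I.seedCost (fun v => col (I.ident v)) q
            (fun v => rankIn I.ids (I.ident v)) (fun v => pre (I.ident v))
            (fun v => z (I.ident v)) a b := by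
    intro a ha
    simp only [BoardProtocol.sumResult, BoardProtocol.coord, ha.trans_le hS.modulus_le, if_true, hsum]
  refine ⟨argMin q ((coloringProtocol n B q).sumResult R D.share (firstSeed I.ids deg col pre ℓ z)),
    ?_, BoardProtocol.Path.single ⟨rfl, fun _ r _ => ?_, by simp [coloringProtocol],
      by simp [coloringProtocol]⟩ rfl⟩
  · have h1 := mul_argMin_le hS.prime.pos
      ((coloringProtocol n B q).sumResult R D.share (firstSeed I.ids deg col pre ℓ z))
    rw [hres _ (argMin_spec hS.prime.pos _).1,
      Finset.sum_congr rfl fun a ha => hres a (Finset.mem_range.1 ha)] at h1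
    exact h1
  · rw [hsum]
    -- The cost summed over all `b` is the largest number that is communicated; it determines the
    -- word size.
    refine lt_of_le_of_lt (Finset.sum_le_card_nsmul _ _ _ fun b _ => seedCost_le _ _ _ _ r b) ?_
    simpa using hS.lt_word

theorem path_secondSeed (deg : ℕ → ℕ) (col : ℕ → Option ℕ) (pre : ℕ → ℕ) (ℓ : ℕ) (z : ℕ → ℕ → ℕ)
    (a : ℕ) :
    ∃ b, (let f := fun b => I.seedCost (fun v => col (I.ident v)) q
            (fun v => rankIn I.ids (I.ident v)) (fun v => pre (I.ident v))
            (fun v => z (I.ident v)) a b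
          q * f b ≤ ∑ b ∈ Finset.range q, f b) ∧
      (coloringProtocol n B q).Path R W K (smallItems N) D.share
        (secondSeed I.ids deg col pre ℓ z a) 1 2
        (nextBit I.ids deg col (extendPrefix q I.ids pre z a b) ℓ) := by
  have hsum : ∀ b, ∑ i, (coloringProtocol n B q).vec (secondSeed I.ids deg col pre ℓ z a)
      (D.share i) b = I.seedCost (fun v => col (I.ident v)) q
            (fun v => rankIn I.ids (I.ident v)) (fun v => pre (I.ident v))
            (fun v => z (I.ident v)) a b := fun b => sum_shareCost D col pre z a b
  have hres : ∀ b < q, (coloringProtocol n B q).sumResult R D.share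
      (secondSeed I.ids deg col pre ℓ z a) b = I.seedCost (fun v => col (I.ident v)) q
            (fun v => rankIn I.ids (I.ident v)) (fun v => pre (I.ident v))
            (fun v => z (I.ident v)) a b := by
    intro b hb
    simp only [BoardProtocol.sumResult, BoardProtocol.coord, hb.trans_le hS.modulus_le, if_true, hsum]
  refine ⟨argMin q ((coloringProtocol n B q).sumResult R D.share
    (secondSeed I.ids deg col pre ℓ z a)), ?_, BoardProtocol.Path.single ⟨rfl, fun _ r _ => ?_,
      by simp [coloringProtocol], by simp [coloringProtocol]⟩ rfl⟩
  · have h1 := mul_argMin_le hS.prime.pos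
      ((coloringProtocol n B q).sumResult R D.share (secondSeed I.ids deg col pre ℓ z a))
    rw [hres _ (argMin_spec hS.prime.pos _).1,
      Finset.sum_congr rfl fun b hb => hres b (Finset.mem_range.1 hb)] at h1
    exact h1
  · rw [hsum]
    refine lt_of_le_of_lt ((seedCost_le _ _ _ _ a r).trans ?_) hS.lt_word
    exact Nat.le_mul_of_pos_left _ hS.prime.pos

theorem path_bit {deg : ℕ → ℕ} {col : ℕ → Option ℕ} {pre : ℕ → ℕ} {ℓ m : ℕ}
    (h : I.PrefixInvariant (fun v => col (I.ident v)) q (ℓ + 1) m fun v => pre (I.ident v)) :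
    ∃ pre' : ℕ → ℕ,
      (I.PrefixInvariant (fun v => col (I.ident v)) q ℓ (m + 1) fun v => pre' (I.ident v)) ∧
      (coloringProtocol n B q).Path R W K (smallItems N) D.share (counts I.ids deg col pre ℓ) 3 6
        (nextBit I.ids deg col pre' ℓ) := by
  obtain ⟨z, hz, p1⟩ := hS.path_counts (K := K) D deg col pre ℓ
  obtain ⟨a, ha, p2⟩ := hS.path_firstSeed (K := K) D deg col pre ℓ z
  obtain ⟨b, hb, p3⟩ := hS.path_secondSeed (K := K) D deg col pre ℓ z a
  exact ⟨_, h.step hS.prime (fun v => (rank_lt v).trans_le hS.n_le) rank_injective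
    (z := fun v => z (I.ident v)) hz ha hb, (p1.trans p2).trans p3⟩

theorem path_bits {deg : ℕ → ℕ} {col : ℕ → Option ℕ} (ℓ : ℕ) : ∀ {pre : ℕ → ℕ} {m : ℕ},
    (I.PrefixInvariant (fun v => col (I.ident v)) q ℓ m fun v => pre (I.ident v)) →
    ∃ pre' : ℕ → ℕ,
      (I.PrefixInvariant (fun v => col (I.ident v)) q 0 (m + ℓ) fun v => pre' (I.ident v)) ∧
      (coloringProtocol n B q).Path R W K (smallItems N) D.share (nextBit I.ids deg col pre ℓ)
        (3 * ℓ) (6 * ℓ) (conflicts I.ids deg col pre') := by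
  induction ℓ with
  | zero => exact fun {pre m} h => ⟨pre, h, BoardProtocol.Path.refl⟩
  | succ ℓ ih =>
    intro pre m h
    obtain ⟨pre', h', p⟩ := hS.path_bit (K := K) D (deg := deg) h
    obtain ⟨pre'', h'', p'⟩ := ih h'
    refine ⟨pre'', by rwa [show m + (ℓ + 1) = m + 1 + ℓ by omega], ?_⟩
    have := p.trans p'
    rwa [show 3 + 3 * ℓ = 3 * (ℓ + 1) by ring, show 6 + 6 * ℓ = 6 * (ℓ + 1) by ring] at this

theorem path_conflicts (deg : ℕ → ℕ) (col : ℕ → Option ℕ) (pre : ℕ → ℕ) :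
    ∃ col' : ℕ → Option ℕ,
      (fun v => col' (I.ident v)) =
        I.keepColors (fun v => col (I.ident v)) (fun v => pre (I.ident v)) I.ident ∧
      (coloringProtocol n B q).Path R W K (smallItems N) D.share (conflicts I.ids deg col pre) 1 2
        (newPhase n B I.ids deg col') := by
  classical
  have hb : ∀ i, (coloringProtocol n B q).vec (conflicts I.ids deg col pre) (D.share i) =
    spread I.ids fun a _ => nbrCount (D.share i).edges a fun w =>
      (col w = none ∧ pre w = pre a) ∧ w < a := fun _ => rfl
  refine ⟨_, funext fun v => ?_, BoardProtocol.Path.single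
    (hS.validStep_spread D rfl rfl hb fun v k => sum_nbrCount_le D v _) rfl⟩
  rw [hS.sumResult_spread D hb v (by omega), D.sum_nbrCount, keepColors, rivals, Finset.filter_filter]

theorem path_phase {deg : ℕ → ℕ} {col : ℕ → Option ℕ}
    (hcol : I.IsPartialColoring fun v => col (I.ident v)) :
    ∃ col' : ℕ → Option ℕ,
      (I.IsPartialColoring fun v => col' (I.ident v)) ∧
      4 * (uncolored fun v => col' (I.ident v)).card ≤ 3 * (uncolored fun v => col (I.ident v)).card ∧
      (coloringProtocol n B q).Path R W K (smallItems N) D.share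
        (nextBit I.ids deg col (fun _ => 0) B) (3 * B + 1) (6 * B + 2)
        (newPhase n B I.ids deg col') := by
  obtain ⟨pre, hpre, p⟩ := hS.path_bits (K := K) D (deg := deg) (col := col) B
    (pre := fun _ => 0) (m := 0) (prefixInvariant_top (q := q) hS.colors_le_pow)
  rw [zero_add] at hpre
  obtain ⟨col', hcol', p'⟩ := hS.path_conflicts (K := K) D deg col pre
  refine ⟨col', ?_, ?_, p.trans p'⟩
  · rw [hcol']
    exact hpre.isPartialColoring_keepColors I.ident.injective hcol
  · rw [hcol']
    exact hpre.card_uncolored_keepColors_le I.ident.injective hS.prime.pos hS.le_modulus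

/-- The number `J` of phases exists only in the analysis: the protocol does not know Δ and stops
phases when the public degrees of the uncolored nodes have a small sum. The hypothesis forces this
after `J` phases, as each phase trades a factor 3/4 in the number of uncolored nodes. -/
theorem path_phases {deg : ℕ → ℕ} (hdeg : ∀ v, deg (I.ident v) = I.G.degree v) (J : ℕ) :
    ∀ {col : ℕ → Option ℕ}, (I.IsPartialColoring fun v => col (I.ident v)) →
    (uncolored fun v => col (I.ident v)).card * 3 ^ J * (I.maxDeg + 1) ≤ 2 * n * 4 ^ J →
    ∃ (k : ℕ) (col' : ℕ → Option ℕ), k ≤ J * (3 * B + 1) ∧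
      (I.IsPartialColoring fun v => col' (I.ident v)) ∧
      ∑ v ∈ uncolored (fun v => col' (I.ident v)), (I.G.degree v + 1) ≤ 2 * n ∧
      (coloringProtocol n B q).Path R W K (smallItems N) D.share (newPhase n B I.ids deg col)
        k (2 * k) (collect I.ids col') := by
  have hsum : ∀ col : ℕ → Option ℕ, ∑ a ∈ I.ids.filter (fun a => col a = none), (deg a + 1) =
      ∑ v ∈ uncolored (fun v => col (I.ident v)), (I.G.degree v + 1) := by
    intro col
    rw [sum_uncolored_ids col fun a => deg a + 1]
    simp only [hdeg]
  have hsmall : ∀ col : ℕ → Option ℕ,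
      ∑ v ∈ uncolored (fun v => col (I.ident v)), (I.G.degree v + 1) ≤ 2 * n →
      newPhase n B I.ids deg col = collect I.ids col := fun col h => by
    rw [newPhase, hsum, if_pos h]
  induction J with
  | zero =>
    intro col hcol hJ
    have h : ∑ v ∈ uncolored (fun v => col (I.ident v)), (I.G.degree v + 1) ≤ 2 * n := by
      have : ∑ v ∈ uncolored (fun v => col (I.ident v)), (I.G.degree v + 1) ≤
          (uncolored (fun v => col (I.ident v))).card * (I.maxDeg + 1) :=
        Finset.sum_le_card_nsmul _ _ _ fun v _ => Nat.add_le_add_right (I.G.degree_le_maxDegree v) 1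
      simp only [pow_zero, mul_one] at hJ
      exact this.trans hJ
    refine ⟨0, col, by simp, hcol, h, ?_⟩
    rw [hsmall col h]
    exact BoardProtocol.Path.refl
  | succ J ih =>
    intro col hcol hJ
    by_cases h : ∑ v ∈ uncolored (fun v => col (I.ident v)), (I.G.degree v + 1) ≤ 2 * n
    · refine ⟨0, col, by simp, hcol, h, ?_⟩
      rw [hsmall col h]
      exact BoardProtocol.Path.refl
    · obtain ⟨col', hcol', hcard, p⟩ := hS.path_phase (K := K) D (deg := deg) hcol
      obtain ⟨k, col'', hk, hcol'', hs, p'⟩ := ih hcol' (by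
        refine Nat.le_of_mul_le_mul_left ?_ (show 0 < 4 by norm_num)
        calc _ = (4 * (uncolored fun v => col' (I.ident v)).card) * 3 ^ J * (I.maxDeg + 1) := by ring
          _ ≤ (3 * (uncolored fun v => col (I.ident v)).card) * 3 ^ J * (I.maxDeg + 1) := by gcongr
          _ = (uncolored fun v => col (I.ident v)).card * 3 ^ (J + 1) * (I.maxDeg + 1) := by ring
          _ ≤ 2 * n * 4 ^ (J + 1) := hJ
          _ = _ := by ring)
      refine ⟨3 * B + 1 + k, col'', ?_, hcol'', hs, ?_⟩
      · linarith [add_one_mul J (3 * B + 1)]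
      · rw [newPhase, hsum, if_neg h]
        have := p.trans p'
        rwa [show 6 * B + 2 + 2 * k = 2 * (3 * B + 1 + k) by ring] at this

end ProtocolSetting

/-! ### Collecting the remaining input and finishing -/

namespace ProtocolSetting

open ColoringState ListColoringInstance

variable {n C M S R W N B q K : ℕ} {I : ListColoringInstance n C} (D : InputDistribution I M S)
  (hS : ProtocolSetting I R W N B q)

theorem inl_mem_collect_iff (col : ℕ → Option ℕ) (e : Sym2 ℕ) :
    Sum.inl e ∈ (coloringProtocol n B q).unionResult D.share (collect I.ids col) ↔
      ∃ u v, I.G.Adj u v ∧ col (I.ident u) = none ∧ e = s(I.ident u, I.ident v) := by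
  classical
  have h : ∀ i, (coloringProtocol n B q).set (collect I.ids col) (D.share i) =
      ((D.share i).edges.filter fun e => ∃ a ∈ e, col a = none).image .inl ∪
        ((D.share i).entries.filter fun t => col t.1 = none).image .inr := fun _ => by
    simp only [coloringProtocol]
  simp only [BoardProtocol.unionResult, Finset.mem_biUnion, Finset.mem_univ, true_and, h,
    Finset.mem_union, Finset.mem_image, Finset.mem_filter, Sum.inl.injEq, exists_eq_right,
    reduceCtorEq, and_false, exists_false, or_false]
  rw [exists_and_right, D.exists_mem_edges_iff]
  constructor
  · rintro ⟨⟨u, v, huv, rfl⟩, a, ha, hc⟩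
    rcases Sym2.mem_iff.1 ha with rfl | rfl
    · exact ⟨u, v, huv, hc, rfl⟩
    · exact ⟨v, u, huv.symm, hc, Sym2.eq_swap⟩
  · rintro ⟨u, v, huv, hc, rfl⟩
    exact ⟨⟨u, v, huv, rfl⟩, _, Sym2.mem_mk_left _ _, hc⟩

theorem inr_mem_collect_iff (col : ℕ → Option ℕ) (t : ℕ × ℕ) :
    Sum.inr t ∈ (coloringProtocol n B q).unionResult D.share (collect I.ids col) ↔
      ∃ v, col (I.ident v) = none ∧ ∃ c ∈ I.L v, t = (I.ident v, c) := by
  classical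
  have h : ∀ i, (coloringProtocol n B q).set (collect I.ids col) (D.share i) =
      ((D.share i).edges.filter fun e => ∃ a ∈ e, col a = none).image .inl ∪
        ((D.share i).entries.filter fun t => col t.1 = none).image .inr := fun _ => by
    simp only [coloringProtocol]
  simp only [BoardProtocol.unionResult, Finset.mem_biUnion, Finset.mem_univ, true_and, h,
    Finset.mem_union, Finset.mem_image, Finset.mem_filter, Sum.inr.injEq, exists_eq_right,
    reduceCtorEq, and_false, exists_false, false_or]
  rw [exists_and_right, D.exists_mem_entries_iff]
  constructor
  · rintro ⟨⟨v, c, hc, rfl⟩, h⟩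
    exact ⟨v, h, c, hc, rfl⟩
  · rintro ⟨v, h, c, hc, rfl⟩
    exact ⟨⟨v, c, hc, rfl⟩, h⟩

/-- An uncolored node accounts for deg edges and deg + 1 list entries, at most twice deg + 1 items.
-/
theorem card_collect_le {col : ℕ → Option ℕ}
    (h : ∑ v ∈ uncolored (fun v => col (I.ident v)), (I.G.degree v + 1) ≤ 2 * n) :
    ((coloringProtocol n B q).unionResult D.share (collect I.ids col)).card ≤ 4 * n := by
  classical
  have hsub : (coloringProtocol n B q).unionResult D.share (collect I.ids col) ⊆
      (uncolored (fun v => col (I.ident v))).biUnion fun v =>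
        ((I.G.neighborFinset v).image fun w => Sum.inl s(I.ident v, I.ident w)) ∪
          ((I.L v).image fun c => Sum.inr (I.ident v, c)) := by
    intro y hy
    simp only [Finset.mem_biUnion, mem_uncolored, Finset.mem_union, Finset.mem_image,
      SimpleGraph.mem_neighborFinset]
    rcases y with e | t
    · obtain ⟨u, v, huv, hc, rfl⟩ := (inl_mem_collect_iff D col e).1 hy
      exact ⟨u, hc, Or.inl ⟨v, huv, rfl⟩⟩
    · obtain ⟨v, hv, c, hc, rfl⟩ := (inr_mem_collect_iff D col t).1 hy
      exact ⟨v, hv, Or.inr ⟨c, hc, rfl⟩⟩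
  refine (Finset.card_le_card hsub).trans (Finset.card_biUnion_le.trans ?_)
  calc _ ≤ ∑ v ∈ uncolored (fun v => col (I.ident v)), 2 * (I.G.degree v + 1) := by
        refine Finset.sum_le_sum fun v _ => (Finset.card_union_le _ _).trans ?_
        have h1 := Finset.card_image_le (s := I.G.neighborFinset v)
          (f := fun w => (Sum.inl s(I.ident v, I.ident w) : InputItem))
        have h2 := Finset.card_image_le (s := I.L v)
          (f := fun c => (Sum.inr (I.ident v, c) : InputItem))
        rw [I.G.card_neighborFinset_eq_degree] at h1
        rw [I.card_L] at h2
        omega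
    _ ≤ 4 * n := by
        rw [← Finset.mul_sum]
        omega

include hS in
-- The collected items contain every constraint that involves an uncolored node, so any completion
-- compatible with them is a list coloring; constraints between colored nodes hold already. All
-- machines choose the same completion, as it depends on the public state only.
theorem path_collect {col : ℕ → Option ℕ} (hcol : I.IsPartialColoring fun v => col (I.ident v))
    (h : ∑ v ∈ uncolored (fun v => col (I.ident v)), (I.G.degree v + 1) ≤ 2 * n) :
    ∃ (o : List (ℕ × ℕ)) (φ : Fin n → ℕ), I.IsListColoring φ ∧
      (o : Multiset (ℕ × ℕ)) = (Finset.univ.val.map fun v => (I.ident v, φ v)) ∧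
      (coloringProtocol n B q).Path R W K (smallItems N) D.share (collect I.ids col) 1 K
        (done o) := by
  classical
  set Y := (coloringProtocol n B q).unionResult D.share (collect I.ids col) with hY
  have hex : ∃ φ, Completes I.ids col Y φ := by
    obtain ⟨φ, hφ, hext⟩ := hcol.exists_extension
    refine ⟨Function.extend I.ident φ 0, fun a ha k hk => ?_, fun a ha hc => ?_, fun a a' haa' => ?_⟩
    · obtain ⟨v, -, rfl⟩ := Finset.mem_map.1 ha
      rw [I.ident.injective.extend_apply]
      exact hext v k hk
    · obtain ⟨v, -, rfl⟩ := Finset.mem_map.1 ha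
      rw [I.ident.injective.extend_apply]
      exact (inr_mem_collect_iff D col _).2 ⟨v, hc, _, hφ.2 v, rfl⟩
    · obtain ⟨u, v, huv, -, he⟩ := (inl_mem_collect_iff D col _).1 haa'
      rcases Sym2.eq_iff.1 he with ⟨rfl, rfl⟩ | ⟨rfl, rfl⟩
      · rw [I.ident.injective.extend_apply, I.ident.injective.extend_apply]
        exact hφ.1 u v huv
      · rw [I.ident.injective.extend_apply, I.ident.injective.extend_apply]
        exact (hφ.1 u v huv).symm
  have hψ := hex.choose_spec
  refine ⟨finish I.ids col Y, fun v => hex.choose (I.ident v), ⟨fun u v huv => ?_, fun v => ?_⟩, ?_,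
    BoardProtocol.Path.single ⟨rfl, by simp [coloringProtocol], fun _ i a ha => ?_, fun _ => ?_⟩ rfl⟩
  · by_cases hu : col (I.ident u) = none
    · exact hψ.2.2 _ _ ((inl_mem_collect_iff D col _).2 ⟨u, v, huv, hu, rfl⟩)
    by_cases hv : col (I.ident v) = none
    · exact (hψ.2.2 _ _ ((inl_mem_collect_iff D col _).2 ⟨v, u, huv.symm, hv, rfl⟩)).symm
    obtain ⟨k, hk⟩ := Option.ne_none_iff_exists'.1 hu
    obtain ⟨k', hk'⟩ := Option.ne_none_iff_exists'.1 hv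
    change hex.choose _ ≠ hex.choose _
    rw [hψ.1 _ (ident_mem_ids u) k hk, hψ.1 _ (ident_mem_ids v) k' hk']
    rintro rfl
    exact hcol.2 u v huv k hk hk'
  · by_cases hv : col (I.ident v) = none
    · obtain ⟨w, -, c, hc, he⟩ := (inr_mem_collect_iff D col _).1 (hψ.2.1 _ (ident_mem_ids v) hv)
      simp only [Prod.mk.injEq, EmbeddingLike.apply_eq_iff_eq] at he
      obtain ⟨rfl, he⟩ := he
      change hex.choose _ ∈ _
      exact he ▸ hc
    · obtain ⟨k, hk⟩ := Option.ne_none_iff_exists'.1 hv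
      change hex.choose _ ∈ _
      rw [hψ.1 _ (ident_mem_ids v) k hk]
      exact hcol.1 v k hk
  · have hval : I.ids.val = Finset.univ.val.map I.ident := rfl
    rw [finish, dif_pos hex, ← Multiset.map_coe, Finset.coe_toList, hval, Multiset.map_map]
    rfl
  · have ha' : a ∈ Y := Finset.mem_biUnion.2 ⟨i, Finset.mem_univ _, ha⟩
    rcases a with e | t
    · obtain ⟨u, v, -, -, rfl⟩ := (inl_mem_collect_iff D col _).1 ha'
      refine ⟨fun e he a ha => ?_, by simp⟩
      cases he
      rcases Sym2.mem_iff.1 ha with rfl | rfl <;> exact hS.ident_lt _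
    · obtain ⟨v, -, c, hc, rfl⟩ := (inr_mem_collect_iff D col _).1 ha'
      refine ⟨by simp, fun t ht => ?_⟩
      cases ht
      exact ⟨hS.ident_lt v, (Finset.mem_range.1 (I.L_subset v hc)).trans_le hS.colors_le⟩
  · exact (card_collect_le D h).trans hS.four_mul_le

/-- The coloring protocol terminates with a list coloring, after `O(log Δ · B)` sums and two
unions. -/
theorem exists_path {J : ℕ} (hS : ProtocolSetting I R W N B q)
    (hJ : 3 ^ J * (I.maxDeg + 1) ≤ 2 * 4 ^ J) :
    ∃ (k : ℕ) (o : List (ℕ × ℕ)) (φ : Fin n → ℕ), k ≤ J * (3 * B + 1) ∧ I.IsListColoring φ ∧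
      (o : Multiset (ℕ × ℕ)) = (Finset.univ.val.map fun v => (I.ident v, φ v)) ∧
      (coloringProtocol n B q).Path R W K (smallItems N) D.share start (k + 3) (2 * K + 2 + 2 * k)
        (done o) := by
  obtain ⟨deg, hdeg, p2⟩ := hS.path_degrees (K := K) D
  obtain ⟨k, col, hk, hcol, hs, p3⟩ := hS.path_phases (K := K) D hdeg J (col := fun _ => none)
    ⟨by simp, by simp⟩ (by
      have : (uncolored fun _ : Fin n => (none : Option ℕ)).card = n := by simp [uncolored]
      rw [this, mul_assoc]
      calc n * (3 ^ J * (I.maxDeg + 1)) ≤ n * (2 * 4 ^ J) := Nat.mul_le_mul_left _ hJ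
        _ = 2 * n * 4 ^ J := by ring)
  obtain ⟨o, φ, hφ, ho, p4⟩ := hS.path_collect (K := K) D hcol hs
  refine ⟨k, o, φ, hk, hφ, ho, ?_⟩
  have := (((hS.path_start (K := K) D).trans p2).trans p3).trans p4
  rwa [show 1 + 1 + k + 1 = k + 3 by ring, show K + 2 + 2 * k + K = 2 * K + 2 + 2 * k by ring]
    at this

end ProtocolSetting

/-! ### Encoding the input shares -/

theorem fits_smallItems {W N : ℕ} (hW : 2 * (N * N) ≤ W) (hW0 : 0 < W) :
    Fits W (smallItems N) 1 := by
  have : NeZero W := ⟨hW0.ne'⟩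
  have hlt : ∀ {a c : ℕ}, a < N → c < N → a * N + c < N * N := fun {a c} ha hc => by
    calc a * N + c < a * N + N := by omega
      _ = (a + 1) * N := by ring
      _ ≤ N * N := Nat.mul_le_mul_right _ ha
  have hinj : ∀ {a c a' c' : ℕ}, c < N → c' < N → a * N + c = a' * N + c' → a = a' ∧ c = c' := by
    intro a c a' c' hc hc' h
    have h1 : a = a' := by
      have := congrArg (· / N) h
      simpa [Nat.add_div_of_dvd_right, Nat.mul_add_div, mul_comm _ N, (by omega : 0 < N),
        Nat.div_eq_of_lt hc, Nat.div_eq_of_lt hc'] using this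
    subst h1
    exact ⟨rfl, by omega⟩
  have hsym : ∀ e : Sym2 ℕ, e.inf ∈ e ∧ e.sup ∈ e ∧ e = s(e.inf, e.sup) := by
    intro e
    induction e with
    | _ a b =>
      rcases le_total a b with h | h
      · simp [h]
      · simp [h, Sym2.eq_swap]
  -- Parity separates edges from list entries, and the two components are the digits in base `N`; an
  -- unordered pair is sorted first.
  refine Fits.of_lt (fun y => y.elim (fun e => 2 * (e.inf * N + e.sup))
    fun t => 2 * (t.1 * N + t.2) + 1) ?_ ?_
  · rintro (e | t) hy (e' | t') hy' h
    · have hb := hy.1 e rfl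
      have hb' := hy'.1 e' rfl
      obtain ⟨h1, h2, h3⟩ := hsym e
      obtain ⟨h1', h2', h3'⟩ := hsym e'
      simp only [Sum.elim_inl] at h
      obtain ⟨h4, h5⟩ := hinj (hb _ h2) (hb' _ h2') (Nat.eq_of_mul_eq_mul_left two_pos h)
      rw [h3, h3', h4, h5]
    · simp only [Sum.elim_inl, Sum.elim_inr] at h
      omega
    · simp only [Sum.elim_inl, Sum.elim_inr] at h
      omega
    · have hb := hy.2 t rfl
      have hb' := hy'.2 t' rfl
      simp only [Sum.elim_inr] at h
      obtain ⟨h4, h5⟩ := hinj hb.2 hb'.2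
        (show t.1 * N + t.2 = t'.1 * N + t'.2 by omega)
      rw [Prod.ext h4 h5]
  · rintro (e | t) hy
    · obtain ⟨h1, h2, -⟩ := hsym e
      have := hlt (hy.1 e rfl _ h1) (hy.1 e rfl _ h2)
      simp only [Sum.elim_inl]
      omega
    · have := hlt (hy.2 t rfl).1 (hy.2 t rfl).2
      simp only [Sum.elim_inr]
      omega

/-- The shares with small identifiers and colors that fit into the memory. -/
def smallShares (N S : ℕ) : Set InputShare :=
  {x | x.words ≤ S ∧ (∀ e ∈ x.edges, ∀ a ∈ e, a < N) ∧ ∀ t ∈ x.entries, t.1 < N ∧ t.2 < N}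

theorem fits_smallShares {W N s : ℕ} (hW2 : 2 ≤ W) (hW : 2 * (N * N) ≤ W) :
    Fits W (smallShares N (2 * s)) (s + 1) := by
  have : NeZero W := ⟨by omega⟩
  refine (((fits_smallItems hW (by omega)).finset hW2 s).image fun T =>
    (⟨T.toLeft, T.toRight⟩ : InputShare)).subset ?_
  rintro ⟨E, T⟩ ⟨h1, h2, h3⟩
  refine ⟨E.disjSum T, ⟨?_, ?_⟩, by simp⟩
  · rintro (e | t) hy
    · exact ⟨fun e' he => by cases he; exact h2 e (by simpa using hy), by simp⟩
    · exact ⟨by simp, fun t' ht => by cases ht; exact h3 t (by simpa using hy)⟩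
  · simp only [InputShare.words] at h1
    rw [Finset.card_disjSum]
    omega

theorem InputDistribution.share_mem_smallShares {n C M S N : ℕ} {I : ListColoringInstance n C}
    (D : InputDistribution I M S) (hid : ∀ v, I.ident v < N) (hC : C ≤ N) (i : Fin M) :
    D.share i ∈ smallShares N S := by
  refine ⟨D.fits i, fun e he a ha => ?_, fun t ht => ?_⟩
  · obtain ⟨u, v, -, rfl⟩ := (D.exists_mem_edges_iff e).1 ⟨i, he⟩
    rcases Sym2.mem_iff.1 ha with rfl | rfl <;> exact hid _
  · obtain ⟨v, c, hc, rfl⟩ := (D.exists_mem_entries_iff t).1 ⟨i, ht⟩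
    exact ⟨hid v, (Finset.mem_range.1 (I.L_subset v hc)).trans_le hC⟩

/-! ### Parameters of the linear memory regime -/

namespace LinearMemory

/-- The number of bits of a number up to `n`. -/
def logSize (n : ℕ) : ℕ := Nat.log 2 n + 1

/-- The length of the vectors that are summed up in one step, divided by `n`. -/
def lengthFactor (κ n : ℕ) : ℕ := 6 * (2 * κ * logSize n + 1)

/-- A bound for the number of steps. -/
def maxSteps (κ n : ℕ) : ℕ := 3 + 3 * logSize n * (3 * κ * logSize n + 1)

/-- Half of the memory of a machine. -/
def halfMemory (κ n : ℕ) : ℕ :=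
  n * (maxSteps κ n * (lengthFactor κ n + 3) + lengthFactor κ n + 5)

/-- The number of words. -/
def numWords (κ n : ℕ) : ℕ := (n + 1) ^ (24 * κ + 20)

/-- The number of machines. -/
def numMachines (κ n m : ℕ) : ℕ := (n + 3 * m) / halfMemory κ n + 1

def memoryConstant (κ : ℕ) : ℕ := (9 * κ + 6) * (12 * κ + 9) + (12 * κ + 11)

theorem one_le_logSize (n : ℕ) : 1 ≤ logSize n := Nat.le_add_left _ _

theorem lt_two_pow_logSize (n : ℕ) : n < 2 ^ logSize n := Nat.lt_pow_succ_log_self one_lt_two n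

theorem logSize_le (n : ℕ) : logSize n ≤ n + 1 := Nat.add_le_add_right (Nat.log_le_self 2 n) 1

theorem halfMemory_le (κ n : ℕ) : halfMemory κ n ≤ memoryConstant κ * n * logSize n ^ 3 := by
  have h1 := one_le_logSize n
  have hR : lengthFactor κ n ≤ (12 * κ + 6) * logSize n := by
    rw [lengthFactor]
    nlinarith
  have hH : maxSteps κ n ≤ (9 * κ + 6) * logSize n ^ 2 := by
    rw [maxSteps]
    nlinarith
  have h3 : logSize n ≤ logSize n ^ 3 := Nat.le_self_pow (by norm_num) _
  rw [halfMemory, memoryConstant, mul_comm _ n, mul_assoc]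
  refine Nat.mul_le_mul_left n ?_
  calc maxSteps κ n * (lengthFactor κ n + 3) + lengthFactor κ n + 5
      ≤ ((9 * κ + 6) * logSize n ^ 2) * ((12 * κ + 6) * logSize n + 3 * logSize n) +
        (12 * κ + 6) * logSize n + 5 * logSize n := by gcongr <;> omega
    _ = (9 * κ + 6) * (12 * κ + 9) * logSize n ^ 3 + (12 * κ + 11) * logSize n := by ring
    _ ≤ (9 * κ + 6) * (12 * κ + 9) * logSize n ^ 3 + (12 * κ + 11) * logSize n ^ 3 := by gcongr
    _ = _ := by ring

theorem five_mul_le_halfMemory (κ n : ℕ) : 5 * n ≤ halfMemory κ n := by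
  rw [halfMemory, mul_comm]
  exact Nat.mul_le_mul_left n (Nat.le_add_left _ _)

theorem isLinearMemoryRegime (κ : ℕ) :
    IsLinearMemoryRegime (fun n => 2 * halfMemory κ n) (numWords κ) (numMachines κ) := by
  refine ⟨2 * memoryConstant κ + 24 * κ + 26, 3, fun n => ?_⟩
  have h5 := five_mul_le_halfMemory κ n
  have hle := halfMemory_le κ n
  have hpow : 1 ≤ logSize n ^ 3 := Nat.one_le_pow _ _ (one_le_logSize n)
  change _ ∧ _ ≤ _ * n * logSize n ^ 3 ∧ _ ∧ ∀ m ≤ _, _ ≤ _ * (n + m) * logSize n ^ 3 ∧ _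
  refine ⟨show n ≤ 2 * halfMemory κ n by omega, ?_, Nat.pow_le_pow_right (Nat.succ_pos n) (by omega), fun m _ => ⟨?_, ?_⟩⟩
  · calc 2 * halfMemory κ n ≤ 2 * (memoryConstant κ * n * logSize n ^ 3) := by gcongr
      _ = (2 * memoryConstant κ) * n * logSize n ^ 3 := by ring
      _ ≤ _ := by gcongr; omega
  · unfold numMachines
    rcases Nat.eq_zero_or_pos n with rfl | hn
    · simp [halfMemory]
    · have hdiv := Nat.div_mul_le_self (n + 3 * m) (halfMemory κ n)
      calc ((n + 3 * m) / halfMemory κ n + 1) * (2 * halfMemory κ n)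
          = 2 * ((n + 3 * m) / halfMemory κ n * halfMemory κ n) + 2 * halfMemory κ n := by ring
        _ ≤ 2 * (n + 3 * m) * 1 + 2 * (memoryConstant κ * n * logSize n ^ 3) := by
          rw [mul_one]; gcongr
        _ ≤ (6 * (n + m)) * logSize n ^ 3 + 2 * (memoryConstant κ * (n + m) * logSize n ^ 3) := by
          refine Nat.add_le_add (Nat.mul_le_mul (by omega) hpow) ?_
          gcongr
          exact Nat.le_add_right _ _
        _ = (2 * memoryConstant κ + 6) * (n + m) * logSize n ^ 3 := by ring
        _ ≤ _ := by gcongr <;> omega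
  · rw [Nat.mul_div_cancel_left _ two_pos]
    unfold numMachines
    rcases Nat.eq_zero_or_pos n with rfl | hn
    · have : m = 0 := by simp_all
      simp [this]
    · have hpos : 0 < halfMemory κ n := by omega
      have := Nat.lt_div_mul_add hpos (a := n + 3 * m)
      rw [add_mul, one_mul]
      omega

theorem clog_le_of_le {κ n C : ℕ} (hC : C ≤ (n + 1) ^ κ) : Nat.clog 2 C ≤ κ * logSize n := by
  rw [Nat.clog_le_iff_le_pow one_lt_two]
  refine hC.trans ?_
  rw [mul_comm, pow_mul]
  exact Nat.pow_le_pow_left (lt_two_pow_logSize n) κ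

/-- A bound on the vector length, and thereby on `q`, by a power of n + 1 whose exponent depends on
κ only, as required for words of O(log n) bits. -/
theorem length_le {κ n : ℕ} (hn : 0 < n) : lengthFactor κ n * n ≤ (n + 1) ^ (12 * κ + 8) := by
  have h1 : lengthFactor κ n ≤ (12 * κ + 6) * (n + 1) := by
    have := one_le_logSize n
    have := logSize_le n
    rw [lengthFactor]
    nlinarith
  have h2 : 12 * κ + 6 ≤ (n + 1) ^ (12 * κ + 6) :=
    Nat.lt_two_pow_self.le.trans (Nat.pow_le_pow_left (by omega) _)
  calc lengthFactor κ n * n ≤ ((n + 1) ^ (12 * κ + 6) * (n + 1)) * (n + 1) := by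
        gcongr
        · exact h1.trans (Nat.mul_le_mul_right _ h2)
        · omega
    _ = _ := by ring

/-- The instances on which the algorithm has to work satisfy the requirements of the protocol. -/
theorem exists_protocolSetting {κ n C : ℕ} (hn : 0 < n) (hC : C ≤ (n + 1) ^ κ) :
    ∃ q, ∀ I : ListColoringInstance n C, (∀ v, I.ident v < (n + 1) ^ κ) →
      ProtocolSetting I (lengthFactor κ n * n) (numWords κ n) ((n + 1) ^ κ) (Nat.clog 2 C) q := by
  -- Bertrand's postulate. Its factor 2 is the reason for the constant 6 = 2 · 3 in `lengthFactor`.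
  obtain ⟨q, hq, hlt, hle⟩ := Nat.exists_prime_lt_and_le_two_mul
    (3 * (2 * Nat.clog 2 C + 1) * n) (by positivity)
  have hqR : q ≤ lengthFactor κ n * n := by
    calc q ≤ 2 * (3 * (2 * Nat.clog 2 C + 1) * n) := hle
      _ ≤ 2 * (3 * (2 * (κ * logSize n) + 1) * n) := by
        gcongr
        exact clog_le_of_le hC
      _ = lengthFactor κ n * n := by rw [lengthFactor]; ring
  refine ⟨q, fun I hid => ⟨hid, hC, by positivity, Nat.le_pow_clog one_lt_two C, hq, hn, hlt.le, hqR,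
    Nat.mul_le_mul_right n (by rw [lengthFactor]; omega), ?_⟩⟩
  have h1 : q ≤ (n + 1) ^ (12 * κ + 8) := hqR.trans (length_le hn)
  have h2 : q + 1 ≤ (n + 1) ^ (12 * κ + 9) := by
    have : 1 ≤ (n + 1) ^ (12 * κ + 8) := Nat.one_le_pow _ _ (Nat.succ_pos n)
    calc q + 1 ≤ (n + 1) ^ (12 * κ + 8) * 2 := by omega
      _ ≤ (n + 1) ^ (12 * κ + 8) * (n + 1) := Nat.mul_le_mul_left _ (by omega)
      _ = _ := by ring
  calc q * ((q + 1) * (n * n))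
      ≤ (n + 1) ^ (12 * κ + 8) * ((n + 1) ^ (12 * κ + 9) * ((n + 1) * (n + 1))) := by
        gcongr <;> omega
    _ = (n + 1) ^ (24 * κ + 19) := by ring
    _ < numWords κ n := Nat.pow_lt_pow_right (by omega) (by omega)

/-- The algorithm whose machines stop at once without any output. -/
def idle (p W : ℕ) : MPCAlgorithm p W where
  start _ _ := []
  send _ _ _ := []
  update _ _ _ := []
  output _ _ := some []

theorem idle_solvesIn {p W C S : ℕ} {I : ListColoringInstance 0 C} (D : InputDistribution I p S)
    (T : ℕ) : (idle p W).SolvesIn D T := by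
  have hrun : ∀ t, (idle p W).run D.share t = fun _ => [] := by
    intro t
    induction t with
    | zero => rfl
    | succ t ih =>
      have : (idle p W).run D.share (t + 1) = (idle p W).round ((idle p W).run D.share t) :=
        Function.iterate_succ_apply' _ _ _
      rw [this, ih]
      rfl
  refine ⟨fun t i => ?_, fun _ => [], fun _ => rfl, fun _ => 0,
    ⟨fun u => isEmptyElim u, fun v => isEmptyElim v⟩, by simp⟩
  rw [hrun]
  simp [MPCAlgorithm.message, idle]

/-- For every number `p ≤ n` of machines there is an algorithm that runs in `O(log p + log Δ log C)`
rounds. -/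
theorem exists_algorithm (κ n C p : ℕ) :
    ∃ A : MPCAlgorithm p (numWords κ n), ∀ I : ListColoringInstance n C,
      C ≤ (n + 1) ^ κ → (∀ v, I.ident v < (n + 1) ^ κ) → 0 < p → (0 < n → p ≤ n) →
      ∀ D : InputDistribution I p (2 * halfMemory κ n),
        ∃ T, A.SolvesIn D T ∧
          T ≤ 2 * (Nat.clog 2 p + 1) + 2 + 2 * (3 * Nat.log 2 I.maxDeg * (3 * Nat.clog 2 C + 1)) := by
  by_cases h : C ≤ (n + 1) ^ κ ∧ 0 < n ∧ p ≤ n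
  -- Outside the parameter range only the empty graph meets the hypotheses, and there stopping at
  -- once is correct.
  swap
  · refine ⟨idle p (numWords κ n), fun I hC _ _ hp D => ?_⟩
    obtain rfl : n = 0 := by
      by_contra hn
      exact h ⟨hC, Nat.pos_of_ne_zero hn, hp (Nat.pos_of_ne_zero hn)⟩
    exact ⟨0, idle_solvesIn D 0, Nat.zero_le _⟩
  obtain ⟨hC, hn, hp⟩ := h
  obtain ⟨q, hq⟩ := exists_protocolSetting hn hC
  have hW1 : n + 1 ≤ numWords κ n := Nat.le_self_pow (by omega) _
  have hW2 : 2 * ((n + 1) ^ κ * (n + 1) ^ κ) ≤ numWords κ n := by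
    calc 2 * ((n + 1) ^ κ * (n + 1) ^ κ) ≤ (n + 1) * ((n + 1) ^ κ * (n + 1) ^ κ) :=
          Nat.mul_le_mul_right _ (by omega)
      _ = (n + 1) ^ (2 * κ + 1) := by ring
      _ ≤ _ := Nat.pow_le_pow_right (by omega) (by omega)
  -- One half of the memory holds the input share. The other half holds the history and the current
  -- step, together with the one tag word by which an encoded share exceeds its half.
  have hmem : maxSteps κ n * (lengthFactor κ n * n + 3) + (lengthFactor κ n * n + 4) + 1 ≤
      halfMemory κ n := by
    calc _ ≤ maxSteps κ n * (lengthFactor κ n * n + 3 * n) + (lengthFactor κ n * n + 4 * n) + n := by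
          gcongr <;> omega
      _ = halfMemory κ n := by rw [halfMemory]; ring
  have h5 := five_mul_le_halfMemory κ n
  have hclog : Nat.clog 2 p ≤ n := by
    rw [Nat.clog_le_iff_le_pow one_lt_two]
    exact hp.trans Nat.lt_two_pow_self.le
  obtain ⟨A, hA⟩ := BoardProtocol.exists_mpcAlgorithm (M := p) (H := maxSteps κ n)
    (K := Nat.clog 2 p + 1) (S := 2 * halfMemory κ n) (coloringProtocol n (Nat.clog 2 C) q)
    (R := lengthFactor κ n * n) (by omega) (by omega) (Nat.succ_pos _)
    ((Nat.le_pow_clog one_lt_two p).trans (Nat.pow_le_pow_right two_pos (Nat.le_succ _)))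
    (fits_smallItems hW2 (by omega)) (fits_smallShares (s := halfMemory κ n) (by omega) hW2) (by omega) (by omega)
  refine ⟨A, fun I _ hid hp0 _ D => ?_⟩
  -- Three phases per binary digit of Δ suffice, because 3³ · 2 = 54 ≤ 64 = 4³.
  have hJ : 3 ^ (3 * Nat.log 2 I.maxDeg) * (I.maxDeg + 1) ≤ 2 * 4 ^ (3 * Nat.log 2 I.maxDeg) := by
    have h1 : I.maxDeg + 1 ≤ 2 * 2 ^ Nat.log 2 I.maxDeg := by
      have := Nat.lt_pow_succ_log_self one_lt_two I.maxDeg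
      rw [pow_succ] at this
      omega
    rw [pow_mul, pow_mul]
    calc (3 ^ 3) ^ Nat.log 2 I.maxDeg * (I.maxDeg + 1)
        ≤ (3 ^ 3) ^ Nat.log 2 I.maxDeg * (2 * 2 ^ Nat.log 2 I.maxDeg) := Nat.mul_le_mul_left _ h1
      _ = 2 * (3 ^ 3 * 2) ^ Nat.log 2 I.maxDeg := by rw [mul_pow]; ring
      _ ≤ 2 * (4 ^ 3) ^ Nat.log 2 I.maxDeg := by gcongr; norm_num
  obtain ⟨k, o, φ, hk, hφ, ho, hv, hdone, hcost⟩ :=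
    ProtocolSetting.exists_path (K := Nat.clog 2 p + 1) D (hq I hid) hJ
  have hdeg : I.maxDeg ≤ n := by
    have : Nonempty (Fin n) := ⟨⟨0, hn⟩⟩
    have := I.G.maxDegree_lt_card_verts
    rw [Fintype.card_fin] at this
    exact this.le
  have hkH : k + 3 ≤ maxSteps κ n := by
    have h1 : Nat.log 2 I.maxDeg ≤ logSize n := (Nat.log_mono_right hdeg).trans (Nat.le_succ _)
    have h2 := clog_le_of_le hC
    rw [maxSteps, add_comm]
    refine Nat.add_le_add_left (hk.trans ?_) 3
    rw [mul_assoc 3 κ]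
    gcongr
  have hlen : 2 * o.length ≤ 2 * halfMemory κ n := by
    have := congrArg Multiset.card ho
    simp at this
    omega
  refine ⟨_, hA n C I D (k + 3) o φ (fun i => D.share_mem_smallShares hid hC i) hkH hv
    ?_ hlen hp0 hφ ho, ?_⟩
  · have : (coloringProtocol n (Nat.clog 2 C) q).out (ColoringState.done o) = some o := rfl
    rw [← this]
    exact congrArg _ hdone
  · refine hcost.le.trans ?_
    gcongr

/-- There are at most nΔ/2 edges, so n + 3m < 5n(Δ + 1), while a machine has room for at least 5n
items. This is what turns the logarithm of the number of machines into O(log Δ). -/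
theorem numMachines_le {κ n C : ℕ} (hn : 0 < n) (I : ListColoringInstance n C) :
    numMachines κ n I.numEdges ≤ I.maxDeg + 1 := by
  rw [numMachines]
  refine Nat.add_le_add_right ?_ 1
  have h5 := five_mul_le_halfMemory κ n
  have hedges : 2 * I.numEdges ≤ n * I.maxDeg := by
    have h1 := I.G.sum_degrees_eq_twice_card_edges
    have h2 : ∑ v, I.G.degree v ≤ n * I.maxDeg := by
      have := Finset.sum_le_card_nsmul Finset.univ (fun v => I.G.degree v) I.maxDeg
        fun v _ => I.G.degree_le_maxDegree v
      simpa using this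
    have h3 : I.numEdges = I.G.edgeFinset.card := rfl
    omega
  rw [← Nat.lt_succ_iff, Nat.div_lt_iff_lt_mul (by omega)]
  have h3 : (I.maxDeg + 1) * (5 * n) ≤ (I.maxDeg + 1) * halfMemory κ n := Nat.mul_le_mul_left _ h5
  rw [Nat.succ_eq_add_one]
  nlinarith

end LinearMemory

/-! ### Round bounds with real logarithms -/

theorem natLog_mul_log_two_le (k : ℕ) : (Nat.log 2 k : ℝ) * Real.log 2 ≤ Real.log k := by
  rcases Nat.eq_zero_or_pos k with rfl | hk
  · simp
  · rw [← Real.log_pow]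
    refine Real.log_le_log (by positivity) ?_
    exact_mod_cast Nat.pow_log_le_self 2 hk.ne'

theorem natClog_sub_one_mul_log_two_le {k : ℕ} (hk : 2 ≤ k) :
    ((Nat.clog 2 k : ℝ) - 1) * Real.log 2 ≤ Real.log k := by
  have h1 : 0 < Nat.clog 2 k := Nat.clog_pos one_lt_two hk
  have h2 := Nat.pow_pred_clog_lt_self one_lt_two (show 1 < k by omega)
  have h3 : ((Nat.clog 2 k : ℝ) - 1) = ((Nat.clog 2 k).pred : ℕ) := by
    rw [Nat.pred_eq_sub_one, Nat.cast_sub h1, Nat.cast_one]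
  rw [h3, ← Real.log_pow]
  refine Real.log_le_log (by positivity) ?_
  exact_mod_cast h2.le

/-- The number of rounds in terms of real logarithms. -/
theorem rounds_le {p d C T : ℕ} (hp : p ≤ d + 1) (hC : 2 ≤ d → d + 1 ≤ C)
    (hT : T ≤ 2 * (Nat.clog 2 p + 1) + 2 + 2 * (3 * Nat.log 2 d * (3 * Nat.clog 2 C + 1))) :
    (T : ℝ) ≤ 200 * (1 + Real.log d * Real.log C) := by
  have hln : (1 / 2 : ℝ) < Real.log 2 := by
    have := Real.log_two_gt_d9
    linarith
  have h0 : 0 ≤ Real.log d * Real.log C :=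
    mul_nonneg (Real.log_natCast_nonneg d) (Real.log_natCast_nonneg C)
  have hclog : Nat.clog 2 p ≤ Nat.log 2 d + 1 := by
    rw [Nat.clog_le_iff_le_pow one_lt_two]
    exact hp.trans (Nat.lt_pow_succ_log_self one_lt_two d)
  rcases Nat.lt_or_ge d 2 with hd | hd
  -- For Δ ≤ 1 the product of logarithms vanishes and no phase is run; the additive 1 in the bound
  -- covers the at most 6 rounds.
  · rw [Nat.log_of_lt hd] at hT hclog
    have : T ≤ 6 := by omega
    have : (T : ℝ) ≤ 6 := by exact_mod_cast this
    linarith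
  · have hC := hC hd
    have hx1 : 1 ≤ Nat.log 2 d := Nat.log_pos one_lt_two hd
    have hy1 : 2 ≤ Nat.clog 2 C := by
      by_contra h
      have := (Nat.le_pow_clog one_lt_two C).trans
        (Nat.pow_le_pow_right two_pos (show Nat.clog 2 C ≤ 1 by omega))
      omega
    have hx := natLog_mul_log_two_le d
    have hy := natClog_sub_one_mul_log_two_le (show 2 ≤ C by omega)
    -- Since Δ ≥ 2 forces C ≥ 3, the ceiling logarithm is at least 2. Subtracting 1 from it
    -- therefore at most halves it and makes it comparable to the real logarithm of C.
    have hT' : (T : ℝ) ≤ 50 * (Nat.log 2 d * (Nat.clog 2 C - 1 : ℝ)) := by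
      have h1 : (T : ℝ) ≤ 2 * ((Nat.log 2 d + 1) + 1) + 2 +
          2 * (3 * Nat.log 2 d * (3 * Nat.clog 2 C + 1)) := by
        have : T ≤ 2 * ((Nat.log 2 d + 1) + 1) + 2 +
          2 * (3 * Nat.log 2 d * (3 * Nat.clog 2 C + 1)) := by omega
        exact_mod_cast this
      have hx1' : (1 : ℝ) ≤ Nat.log 2 d := by exact_mod_cast hx1
      have hy1' : (2 : ℝ) ≤ Nat.clog 2 C := by exact_mod_cast hy1
      nlinarith
    have hxy : (Nat.log 2 d * (Nat.clog 2 C - 1 : ℝ)) ≤ 4 * (Real.log d * Real.log C) := by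
      have hy0 : (0 : ℝ) ≤ Nat.clog 2 C - 1 := by
        have : (2 : ℝ) ≤ Nat.clog 2 C := by exact_mod_cast hy1
        linarith
      have hx' : (Nat.log 2 d : ℝ) ≤ 2 * Real.log d := by
        nlinarith [(Nat.cast_nonneg (Nat.log 2 d) : (0 : ℝ) ≤ _)]
      have hy' : (Nat.clog 2 C - 1 : ℝ) ≤ 2 * Real.log C := by nlinarith
      calc _ ≤ (2 * Real.log d) * (2 * Real.log C) :=
            mul_le_mul hx' hy' hy0 (by linarith [Real.log_natCast_nonneg d])
        _ = _ := by ring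
    linarith

/-- For d ≥ 2, d + 1 ≤ d² gives log(d + 1) ≤ 2 log d; for smaller d both sides are 0. -/
theorem log_mul_log_le_of_le_pow {d C e : ℕ} (hC : C ≤ (d + 1) ^ e) :
    Real.log d * Real.log C ≤ 2 * e * Real.log d ^ 2 := by
  have h0 := Real.log_natCast_nonneg d
  have h1 : Real.log C ≤ e * Real.log (d + 1 : ℕ) := by
    rcases Nat.eq_zero_or_pos C with rfl | hC0
    · simpa using mul_nonneg (Nat.cast_nonneg e) (Real.log_natCast_nonneg (d + 1))
    · rw [← Real.log_pow]
      exact Real.log_le_log (by exact_mod_cast hC0) (by exact_mod_cast hC)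
  rcases Nat.lt_or_ge d 2 with hd | hd
  · have : Real.log d = 0 := by interval_cases d <;> simp
    simp [this]
  · have h2 : Real.log (d + 1 : ℕ) ≤ 2 * Real.log d := by
      have : Real.log (d + 1 : ℕ) ≤ Real.log ((d : ℝ) ^ 2) := by
        refine Real.log_le_log (by positivity) ?_
        have : d + 1 ≤ d ^ 2 := by nlinarith
        exact_mod_cast this
      rwa [Real.log_pow, Nat.cast_two] at this
    calc Real.log d * Real.log C ≤ Real.log d * (e * (2 * Real.log d)) :=
          mul_le_mul_of_nonneg_left
            (h1.trans (mul_le_mul_of_nonneg_left h2 (Nat.cast_nonneg e))) h0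
      _ = _ := by ring

theorem ListColoringInstance.maxDeg_lt_colors {n C : ℕ} (hn : 0 < n)
    (I : ListColoringInstance n C) : I.maxDeg + 1 ≤ C := by
  have : Nonempty (Fin n) := ⟨⟨0, hn⟩⟩
  obtain ⟨v, hv⟩ := I.G.exists_maximal_degree_vertex
  have h := Finset.card_le_card (I.L_subset v)
  rw [I.card_L, Finset.card_range, ← hv] at h
  exact h

theorem mainTheorem6 (κ : ℕ) :
    ∃ (S W : ℕ → ℕ) (M : ℕ → ℕ → ℕ) (A : (n C p : ℕ) → MPCAlgorithm p (W n)),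
      IsLinearMemoryRegime S W M ∧
      (∃ K : ℝ, ∀ (n C : ℕ) (I : ListColoringInstance n C),
        C ≤ (n + 1) ^ κ → (∀ v, I.ident v < (n + 1) ^ κ) →
        ∀ D : InputDistribution I (M n I.numEdges) (S n),
          ∃ T : ℕ, (A n C (M n I.numEdges)).SolvesIn D T ∧
            (T : ℝ) ≤ K * (1 + Real.log I.maxDeg * Real.log C)) ∧
      (∀ d : ℕ, ∃ K : ℝ, ∀ (n C : ℕ) (I : ListColoringInstance n C),
        C ≤ (n + 1) ^ κ → (∀ v, I.ident v < (n + 1) ^ κ) → C ≤ (I.maxDeg + 1) ^ d →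
        ∀ D : InputDistribution I (M n I.numEdges) (S n),
          ∃ T : ℕ, (A n C (M n I.numEdges)).SolvesIn D T ∧
            (T : ℝ) ≤ K * (1 + Real.log I.maxDeg ^ 2)) := by
  choose A hA using LinearMemory.exists_algorithm κ
  have main : ∀ (n C : ℕ) (I : ListColoringInstance n C),
      C ≤ (n + 1) ^ κ → (∀ v, I.ident v < (n + 1) ^ κ) →
      ∀ D : InputDistribution I (LinearMemory.numMachines κ n I.numEdges)
        (2 * LinearMemory.halfMemory κ n),
        ∃ T : ℕ, (A n C (LinearMemory.numMachines κ n I.numEdges)).SolvesIn D T ∧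
          (T : ℝ) ≤ 200 * (1 + Real.log I.maxDeg * Real.log C) := by
    intro n C I hC hid D
    rcases Nat.eq_zero_or_pos n with rfl | hn
    -- Without nodes the color space may be empty, so the bound Δ + 1 ≤ C is unavailable; it is not
    -- needed as Δ = 0, and division by the zero memory size gives one machine.
    · obtain ⟨T, hT, hle⟩ := hA 0 C _ I hC hid (Nat.succ_pos _) (fun h => absurd h (lt_irrefl 0)) D
      have hdeg : I.maxDeg = 0 := I.G.maxDegree_of_subsingleton
      refine ⟨T, hT, rounds_le (Nat.add_le_add_right ?_ 1) (fun h => by omega) hle⟩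
      simp [LinearMemory.halfMemory]
    · have hp := LinearMemory.numMachines_le (κ := κ) hn I
      have hdeg : I.maxDeg < n := by
        have : Nonempty (Fin n) := ⟨⟨0, hn⟩⟩
        have := I.G.maxDegree_lt_card_verts
        rwa [Fintype.card_fin] at this
      obtain ⟨T, hT, hle⟩ := hA n C _ I hC hid (Nat.succ_pos _) (fun _ => hp.trans hdeg) D
      exact ⟨T, hT, rounds_le hp (fun _ => I.maxDeg_lt_colors hn) hle⟩
  refine ⟨fun n => 2 * LinearMemory.halfMemory κ n, LinearMemory.numWords κ,
    LinearMemory.numMachines κ, A, LinearMemory.isLinearMemoryRegime κ, ⟨200, main⟩,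
    fun d => ⟨200 * (1 + 2 * d), fun n C I hC hid hCd D => ?_⟩⟩
  obtain ⟨T, hT, hle⟩ := main n C I hC hid D
  refine ⟨T, hT, hle.trans ?_⟩
  have h1 := log_mul_log_le_of_le_pow hCd
  have h2 : 0 ≤ Real.log I.maxDeg ^ 2 := sq_nonneg _
  have h3 : (0 : ℝ) ≤ d := Nat.cast_nonneg d
  nlinarith
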